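/- Let $I\subseteq[0,1]$ be a set of real numbers satisfying the descending chain condition (DCC), i.e. every decreasing sequence in $I$ is eventually constant. Then there is a finite subset $I_0\subseteq I$ with the following property. Let $k$ be an arbitrary field (of any characteristic, possibly imperfect), let $C$ be a proper regular curve over $k$ (an integral scheme of dimension one, proper over $k$, all of whose local rings are regular; it need be neither smooth nor geometrically integral over $k$), and let $\Delta=\sum_i a_iP_i$ be an $\mathbb{R}$-divisor on $C$, where the $P_i$ are finitely many distinct closed points and all $a_i\neq 0$. Let $K_C$ be a canonical divisor of $C$, i.e. a divisor with $\mathcal{O}_C(K_C)\cong\omega_C$, the dualizing sheaf of $C$ over $k$; equivalently, the divisor of a nonzero Weil differential of the function field of $C$ over $k$. If all coefficients $a_i$ belong to $I$ and $K_C+\Delta\equiv 0$, i.e. $\deg_k(K_C+\Delta)=0$, where $\deg_k(\sum_j r_jQ_j)=\sum_j[k(Q_j):k]\,r_j$, then all $a_i$ belong to $I_0$. The set $I_0$ depends only on $I$, not on $k$, $C$ or $\Delta$. -/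

import Mathlib

open AlgebraicGeometry CategoryTheory

universe u

/-- The descending chain condition: every (weakly) decreasing sequence in `I` is eventually
constant. -/
def IsDCC (I : Set ℝ) : Prop :=
  ∀ a : ℕ → ℝ, (∀ n, a n ∈ I) → Antitone a → ∃ N, ∀ n, N ≤ n → a n = a (n + 1)

/-- A proper regular curve over a field `k`: an integral scheme of dimension one, proper over `k`
(in particular separated and of finite type), all of whose local rings are regular.
It need be neither smooth nor geometrically integral over `k`. -/
structure ProperRegularCurve (k : Type u) [Field k] where
  X : Scheme.{u}
  toBase : X ⟶ Spec (CommRingCat.of k)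
  isIntegral : IsIntegral X
  isProper : IsProper toBase
  dim_eq_one : topologicalKrullDim X = 1
  regular : ∀ x : X, IsRegularLocalRing (X.presheaf.stalk x)

namespace ProperRegularCurve

variable {k : Type u} [Field k] (C : ProperRegularCurve k)

instance : IsIntegral C.X := C.isIntegral

instance : IsProper C.toBase := C.isProper

instance : IsLocallyNoetherian C.X := LocallyOfFiniteType.isLocallyNoetherian C.toBase

/-- The closed points of the curve, i.e. its prime divisors. -/
abbrev ClosedPoint : Type u := {x : C.X // IsClosed ({x} : Set C.X)}

/-- The structure map `k → 𝒪_{C,x}`. -/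
noncomputable def toStalk (x : C.X) : k →+* C.X.presheaf.stalk x :=
  ((Scheme.ΓSpecIso (CommRingCat.of k)).inv ≫ C.toBase.appTop ≫
    C.X.presheaf.germ ⊤ x trivial).hom

/-- The function field `k(C)` as an extension of `k`. -/
noncomputable instance : Algebra k C.X.functionField :=
  (C.toStalk (genericPoint C.X)).toAlgebra

theorem algebraMap_toStalk (x : C.X) (c : k) :
    algebraMap (C.X.presheaf.stalk x) C.X.functionField (C.toStalk x c) =
      algebraMap k C.X.functionField c := by
  have h := C.X.presheaf.germ_stalkSpecializes (U := ⊤) (y := x) trivial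
    ((genericPoint_spec C.X).specializes trivial)
  exact DFunLike.congr_fun (congrArg CommRingCat.Hom.hom h)
    (((Scheme.ΓSpecIso (CommRingCat.of k)).inv ≫ C.toBase.appTop).hom c)

/-- The residue field `k(P)` as an extension of `k`. -/
noncomputable instance (x : C.X) : Algebra k (C.X.residueField x) :=
  ((C.X.residue x).hom.comp (C.toStalk x)).toAlgebra

/-- Weil divisors with coefficients in `R`: finite formal sums `∑ rᵢ Pᵢ` of closed points. -/
abbrev WeilDivisor (R : Type*) [Zero R] : Type _ := C.ClosedPoint →₀ R

variable {C}

/-- The set of coefficients of a divisor: the multiplicities of its components. -/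
def WeilDivisor.coeffs {R : Type*} [Zero R] (D : C.WeilDivisor R) : Set R :=
  {r | ∃ P ∈ D.support, D P = r}

/-- An integral divisor viewed as an `ℝ`-divisor. -/
noncomputable def WeilDivisor.toReal (D : C.WeilDivisor ℤ) : C.WeilDivisor ℝ :=
  D.mapRange (fun n : ℤ => (n : ℝ)) Int.cast_zero

/-- The degree over `k`: `deg_k (∑ rᵢ Pᵢ) = ∑ [k(Pᵢ) : k] rᵢ`. -/
noncomputable def WeilDivisor.degree (D : C.WeilDivisor ℝ) : ℝ :=
  D.sum fun P r => (Module.finrank k (C.X.residueField P.1) : ℝ) * r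

/-- `D ≡ 0`: the intersection number of `D` with every proper curve in `C` vanishes. The only
such curve is `C` itself and the number is `deg_k D`. -/
def WeilDivisor.IsNumTrivial (D : C.WeilDivisor ℝ) : Prop := D.degree = 0

variable (C)

/-- The repartitions (adeles) of `C`: families `(α_P)` of rational functions, indexed by the
closed points, such that `α_P ∈ 𝒪_{C,P}` for all but finitely many `P`. -/
noncomputable def adele : Submodule k (C.ClosedPoint → C.X.functionField) where
  carrier := {α | ∀ᶠ P in Filter.cofinite,
    α P ∈ (algebraMap (C.X.presheaf.stalk P.1) C.X.functionField).range}
  zero_mem' := by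
    simp only [Set.mem_ofPred_eq]
    exact Filter.Eventually.of_forall fun P => zero_mem _
  add_mem' := by
    intro α β ha hb
    simp only [Set.mem_ofPred_eq] at ha hb ⊢
    filter_upwards [ha, hb] with P h₁ h₂ using add_mem h₁ h₂
  smul_mem' := by
    intro c α h
    simp only [Set.mem_ofPred_eq] at h ⊢
    filter_upwards [h] with P hP
    rw [Pi.smul_apply, Algebra.smul_def]
    exact mul_mem ⟨C.toStalk P.1 c, C.algebraMap_toStalk P.1 c⟩ hP

variable {C}

/-- `α ∈ 𝔸(D)`, i.e. `v_P(α_P) + D(P) ≥ 0` for all `P`, with `v_P(0) = ∞`. -/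
def MemAdele (D : C.WeilDivisor ℤ) (α : C.ClosedPoint → C.X.functionField) : Prop :=
  ∀ P, α P = 0 ∨ 0 ≤ Scheme.ord (α P) P.1 + D P

/-- `K` is a canonical divisor of `C`, i.e. the divisor of a nonzero Weil differential `ω`:
a `k`-linear functional on the adeles which vanishes on the diagonally embedded rational functions,
and on `𝔸(D)` exactly for the divisors `D ≤ K`.

As `H¹(C, 𝒪(D)) = 𝔸 / (𝔸(D) + k(C))`, such functionals are the rational sections of the dualizing
sheaf `ω_C`, and `𝒪(K) ≅ ω_C`. This also covers curves which are not smooth over `k`, where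
Kähler differentials do not give `ω_C`. -/
def IsCanonical (K : C.WeilDivisor ℤ) : Prop :=
  ∃ ω : C.adele →ₗ[k] k, ω ≠ 0 ∧
    (∀ α : C.adele, (∃ f, ∀ P, α.1 P = f) → ω α = 0) ∧
    ∀ D : C.WeilDivisor ℤ, (∀ α : C.adele, MemAdele D α.1 → ω α = 0) ↔ D ≤ K

end ProperRegularCurve

/-!
The repartitions of a curve satisfy Weil's form of the Riemann–Roch theorem without any smoothness
assumption, so `deg K = 2 ℓ(K) - 2d` where `d = [H⁰(C, 𝒪) : k]`. If `Δ ≠ 0`, then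
`deg K = -deg Δ < 0`, so `ℓ(K) = 0` and `deg Δ = 2d`. Every residue field `k(P)` contains the field
of constants `H⁰(C, 𝒪)`, so `[k(P) : k] = d m_P` and `∑ m_P Δ(P) = 2` with positive integers `m_P`.
This is a sum of positive elements of `I`, of boundedly many because `I` has a smallest positive
element, and tuples from `I` of a given length and sum are finite in number because they form an
antichain in a well-quasi-order.
-/

/-! ### Relative length of submodules -/

section RelLength

variable {R V W : Type*} [Ring R] [AddCommGroup V] [Module R V] [AddCommGroup W] [Module R W]

/-- The length of `B / (A ∩ B)`. Not requiring `A ≤ B` keeps the isomorphism theorems free of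
side conditions. -/
noncomputable def relLength (A B : Submodule R V) : ℕ∞ :=
  Module.length R (B ⧸ A.submoduleOf B)

theorem relLength_eq_zero {A B : Submodule R V} : relLength A B = 0 ↔ B ≤ A := by
  rw [relLength, Module.length_eq_zero_iff, Submodule.Quotient.subsingleton_iff,
    Submodule.submoduleOf, Submodule.comap_subtype_eq_top]

theorem relLength_bot (B : Submodule R V) : relLength ⊥ B = Module.length R B := by
  have h : (⊥ : Submodule R V).submoduleOf B = ⊥ := by
    ext x
    simp [Submodule.submoduleOf]
  exact (Submodule.quotEquivOfEqBot _ h).length_eq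

theorem relLength_ker_top {f : V →ₗ[R] W} (hf : Function.Surjective f) :
    relLength (LinearMap.ker f) ⊤ = Module.length R W :=
  ((f.comp (⊤ : Submodule R V).subtype).quotKerEquivOfSurjective fun w =>
    let ⟨v, hv⟩ := hf w; ⟨⟨v, trivial⟩, hv⟩).length_eq

theorem relLength_inf_right (A B : Submodule R V) : relLength (A ⊓ B) B = relLength A B := by
  have h : (A ⊓ B).submoduleOf B = A.submoduleOf B := by
    ext x
    simp [Submodule.submoduleOf]
  rw [relLength, relLength, h]

theorem relLength_sup (A B : Submodule R V) : relLength A (A ⊔ B) = relLength A B := by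
  rw [← relLength_inf_right A B, sup_comm, inf_comm]
  exact (LinearMap.quotientInfEquivSupQuotient B A).length_eq.symm

theorem relLength_trans {A B C : Submodule R V} (hAB : A ≤ B) (hBC : B ≤ C) :
    relLength A C = relLength A B + relLength B C := by
  let f : (B ⧸ A.submoduleOf B) →ₗ[R] (C ⧸ A.submoduleOf C) :=
    Submodule.mapQ _ _ (Submodule.inclusion hBC) fun _ hx => hx
  let g : (C ⧸ A.submoduleOf C) →ₗ[R] (C ⧸ B.submoduleOf C) :=
    Submodule.factor fun _ hx => hAB hx
  refine Module.length_eq_add_of_exact f g ?_ (Submodule.factor_surjective _) ?_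
  · rw [← LinearMap.ker_eq_bot]
    exact Submodule.ker_liftQ_eq_bot _ _ _ fun x hx =>
      (Submodule.Quotient.mk_eq_zero (A.submoduleOf C)).1 hx
  · refine LinearMap.exact_iff.2 ((Submodule.ker_mapQ ..).trans
      (Eq.trans ?_ (Submodule.range_mapQ ..).symm))
    rw [Submodule.comap_id, Submodule.range_inclusion]
    rfl

theorem relLength_mono_right {A B C : Submodule R V} (h : B ≤ C) :
    relLength A B ≤ relLength A C := by
  rw [← relLength_sup A B, ← relLength_sup A C,
    relLength_trans (le_sup_left : A ≤ A ⊔ B) (sup_le_sup_left h A)]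
  exact le_self_add

theorem relLength_eq_inf_add_sup {A B : Submodule R V} (h : A ≤ B) (F : Submodule R V) :
    relLength A B = relLength (A ⊓ F) (B ⊓ F) + relLength (A ⊔ F) (B ⊔ F) := by
  have hinf : relLength (A ⊓ F) (B ⊓ F) = relLength A (A ⊔ B ⊓ F) := by
    rw [relLength_sup, ← relLength_inf_right A, ← inf_assoc, inf_eq_left.2 h]
  have hsup : relLength (A ⊔ F) (B ⊔ F) = relLength (A ⊔ B ⊓ F) B := by
    rw [show B ⊔ F = (A ⊔ F) ⊔ B by rw [sup_right_comm, sup_eq_right.2 h], relLength_sup,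
      ← relLength_inf_right, sup_inf_assoc_of_le F h, inf_comm]
  rw [hinf, hsup]
  exact relLength_trans le_sup_left (sup_le h inf_le_left)

theorem relLength_map {f : V →ₗ[R] W} (hf : Function.Injective f) (A B : Submodule R V) :
    relLength (A.map f) (B.map f) = relLength A B := by
  refine (LinearEquiv.length_eq (Submodule.Quotient.equiv _ _
    (Submodule.equivMapOfInjective f hf B) ?_)).symm
  ext x
  obtain ⟨x, rfl⟩ := (Submodule.equivMapOfInjective f hf B).surjective x
  simp [Submodule.submoduleOf, hf.eq_iff]

theorem relLength_comap {f : V →ₗ[R] W} (hf : Function.Injective f) (A B : Submodule R W) :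
    relLength (A.comap f) (B.comap f) =
      relLength (A ⊓ LinearMap.range f) (B ⊓ LinearMap.range f) := by
  rw [← relLength_map hf, Submodule.map_comap_eq, Submodule.map_comap_eq, inf_comm, inf_comm B]

end RelLength

section RelLengthField

variable {k V : Type*} [Field k] [AddCommGroup V] [Module k V]

theorem finite_of_length_ne_top (h : Module.length k V ≠ ⊤) : Module.Finite k V :=
  have := (isFiniteLength_iff_isNoetherian_isArtinian.1 (Module.length_ne_top_iff.1 h)).1
  inferInstance

theorem toNat_relLength (A B : Submodule k V) :
    (relLength A B).toNat = Module.finrank k (B ⧸ A.submoduleOf B) := by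
  rw [relLength, Module.length_eq_rank]
  exact Cardinal.toNat_toENat _

theorem toNat_relLength_restrictScalars {k' : Type*} [Field k'] [Algebra k k'] [Module k' V]
    [IsScalarTower k k' V] (A B : Submodule k' V) :
    (relLength (A.restrictScalars k) (B.restrictScalars k)).toNat =
      Module.finrank k k' * (relLength A B).toNat := by
  rw [toNat_relLength, toNat_relLength, Module.finrank_mul_finrank]
  exact (Submodule.Quotient.restrictScalarsEquiv k (A.submoduleOf B)).finrank_eq

end RelLengthField

open WithZero

/-! ### Places, divisors and adeles -/

/-- A family of normalized discrete valuations of `F` over `k`, the places of a curve with function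
field `F`. Valuations are multiplicative, so a pole of order `n` at `P` is `v P x = exp n`. -/
structure PlaceFamily (k F ι : Type*) [Field k] [Field F] [Algebra k F] where
  v : ι → Valuation F ℤᵐ⁰
  map_const_le_one : ∀ P c, v P (algebraMap k F c) ≤ 1
  surjective : ∀ P, Function.Surjective (v P)

namespace PlaceFamily

variable {k F ι : Type*} [Field k] [Field F] [Algebra k F]

section LocalIdeal

variable (𝓥 : PlaceFamily k F ι)

theorem map_smul_le (P : ι) (c : k) (x : F) : 𝓥.v P (c • x) ≤ 𝓥.v P x := by
  rw [Algebra.smul_def, map_mul]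
  exact mul_le_of_le_one_left' (𝓥.map_const_le_one P c)

/-- The fractional ideal `𝔪_P ^ (-n)` of the functions with a pole of order at most `n` at `P`. -/
def localIdeal (P : ι) (n : ℤ) : Submodule k F where
  carrier := {x | 𝓥.v P x ≤ exp n}
  zero_mem' := by simp
  add_mem' := (𝓥.v P).map_add_le
  smul_mem' c _ hx := (𝓥.map_smul_le P c _).trans hx

@[simp]
theorem mem_localIdeal {P : ι} {n : ℤ} {x : F} : x ∈ 𝓥.localIdeal P n ↔ 𝓥.v P x ≤ exp n :=
  Iff.rfl

theorem mem_localIdeal_neg_one {P : ι} {x : F} : x ∈ 𝓥.localIdeal P (-1) ↔ 𝓥.v P x < 1 := by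
  rw [mem_localIdeal, ← lt_mul_exp_iff_le exp_ne_zero, ← exp_add, neg_add_cancel, exp_zero]

theorem localIdeal_mono (P : ι) : Monotone (𝓥.localIdeal P) :=
  fun _ _ h _ hx => le_trans hx (exp_le_exp.2 h)

/-- The degree over `k` of the residue field of `P`; it is `0` if that field is infinite
over `k`. -/
noncomputable def resDegree (P : ι) : ℕ :=
  (relLength (𝓥.localIdeal P (-1)) (𝓥.localIdeal P 0)).toNat

/-- All residue fields are finite over `k`. -/
def FiniteResidue : Prop := ∀ P, relLength (𝓥.localIdeal P (-1)) (𝓥.localIdeal P 0) ≠ ⊤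

variable {𝓥}

theorem exists_eq_exp (P : ι) (n : ℤ) : ∃ t ≠ 0, 𝓥.v P t = exp n := by
  obtain ⟨t, ht⟩ := 𝓥.surjective P (exp n)
  exact ⟨t, fun h => exp_ne_zero (by rw [← ht, h, map_zero]), ht⟩

theorem map_mulLeft_localIdeal {P : ι} {t : F} {a : ℤ} (ht : 𝓥.v P t = exp a) (n : ℤ) :
    (𝓥.localIdeal P n).map (LinearMap.mulLeft k t) = 𝓥.localIdeal P (a + n) := by
  have ht0 : t ≠ 0 := by
    rintro rfl
    exact exp_ne_zero (ht.symm.trans (map_zero _))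
  ext x
  constructor
  · rintro ⟨y, hy, rfl⟩
    rw [mem_localIdeal, LinearMap.mulLeft_apply, map_mul, ht, exp_add]
    exact mul_le_mul_right hy _
  · intro hx
    refine ⟨t⁻¹ * x, ?_, mul_inv_cancel_left₀ ht0 x⟩
    calc 𝓥.v P (t⁻¹ * x) = exp (-a) * 𝓥.v P x := by rw [map_mul, map_inv₀, ht, exp_neg]
      _ ≤ exp (-a) * exp (a + n) := mul_le_mul_right hx _
      _ = exp n := by rw [← exp_add, neg_add_cancel_left]

theorem relLength_localIdeal_add (P : ι) (a m n : ℤ) :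
    relLength (𝓥.localIdeal P (a + m)) (𝓥.localIdeal P (a + n)) =
      relLength (𝓥.localIdeal P m) (𝓥.localIdeal P n) := by
  obtain ⟨t, ht, hv⟩ := 𝓥.exists_eq_exp P a
  rw [← map_mulLeft_localIdeal hv, ← map_mulLeft_localIdeal hv,
    relLength_map (mul_right_injective₀ ht)]

theorem relLength_localIdeal (hf : 𝓥.FiniteResidue) (P : ι) (n : ℤ) (e : ℕ) :
    relLength (𝓥.localIdeal P n) (𝓥.localIdeal P (n + e)) = (e * 𝓥.resDegree P : ℕ) := by
  induction e with
  | zero => simp [relLength_eq_zero]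
  | succ e ih =>
    have hstep := 𝓥.relLength_localIdeal_add P (n + e + 1) (-1) 0
    rw [add_neg_cancel_right, add_zero, ← ENat.natCast_toNat (hf P), ← resDegree] at hstep
    rw [Nat.cast_succ, ← add_assoc, relLength_trans (𝓥.localIdeal_mono P (by omega : n ≤ n + e))
      (𝓥.localIdeal_mono P (by omega)), ih, hstep, ← Nat.cast_add, Nat.succ_mul]

theorem resDegree_pos (hf : 𝓥.FiniteResidue) (P : ι) : 0 < 𝓥.resDegree P := by
  rw [Nat.pos_iff_ne_zero, resDegree, Ne, ENat.toNat_eq_zero, not_or]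
  refine ⟨fun h => ?_, hf P⟩
  have h1 : 𝓥.v P 1 ≤ exp (-1) := relLength_eq_zero.1 h (show 𝓥.v P 1 ≤ exp 0 by simp)
  rw [map_one, ← exp_zero, exp_le_exp] at h1
  omega

end LocalIdeal

section Degree

variable (𝓥 : PlaceFamily k F ι)

/-- The degree of a divisor over `k`. -/
noncomputable def degree : (ι →₀ ℤ) →+ ℤ :=
  Finsupp.liftAddHom fun P => AddMonoidHom.mulRight (𝓥.resDegree P : ℤ)

theorem degree_eq_sum (D : ι →₀ ℤ) : 𝓥.degree D = D.sum fun P n => n * 𝓥.resDegree P := rfl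

@[simp]
theorem degree_single (P : ι) (n : ℤ) : 𝓥.degree (.single P n) = n * 𝓥.resDegree P :=
  Finsupp.liftAddHom_apply_single _ _ _

theorem degree_nonneg {D : ι →₀ ℤ} (hD : 0 ≤ D) : 0 ≤ 𝓥.degree D :=
  Finset.sum_nonneg fun P _ => mul_nonneg (hD P) (Nat.cast_nonneg _)

theorem degree_mono : Monotone 𝓥.degree := fun D D' h => by
  simpa using 𝓥.degree_nonneg (sub_nonneg.2 h)

end Degree

section AdeleSpace

variable (𝓥 : PlaceFamily k F ι)

/-- The space `𝔸(D)` of families of functions with poles bounded by the divisor `D`. -/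
def adeleSpace (D : ι →₀ ℤ) : Submodule k (ι → F) where
  carrier := {α | ∀ P, 𝓥.v P (α P) ≤ exp (D P)}
  zero_mem' := by simp
  add_mem' ha hb P := (𝓥.v P).map_add_le (ha P) (hb P)
  smul_mem' c _ hx P := (𝓥.map_smul_le P c _).trans (hx P)

theorem adeleSpace_mono : Monotone 𝓥.adeleSpace :=
  fun _ _ h _ hx P => le_trans (hx P) (exp_le_exp.2 (h P))

variable {𝓥}

theorem single_mem_adeleSpace [DecidableEq ι] {D : ι →₀ ℤ} {P : ι} {x : F} :
    Pi.single P x ∈ 𝓥.adeleSpace D ↔ x ∈ 𝓥.localIdeal P (D P) := by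
  refine ⟨fun h => by simpa using h P, fun h Q => ?_⟩
  rcases eq_or_ne Q P with rfl | hQ
  · simpa using h
  · simp [hQ]

theorem adeleSpace_add_single [DecidableEq ι] (D : ι →₀ ℤ) (P : ι) (e : ℕ) :
    𝓥.adeleSpace (D + .single P (e : ℤ)) =
      𝓥.adeleSpace D ⊔ (𝓥.localIdeal P (D P + e)).map (LinearMap.single k (fun _ => F) P) := by
  apply le_antisymm
  · intro α hα
    have hsplit : Function.update α P 0 + Pi.single P (α P) = α := by
      ext Q
      rcases eq_or_ne Q P with rfl | hQ <;> simp [*]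
    rw [← hsplit]
    refine Submodule.add_mem_sup (fun Q => ?_) (Submodule.mem_map_of_mem (by simpa using hα P))
    rcases eq_or_ne Q P with rfl | hQ
    · simp
    · simpa [hQ] using hα Q
  · refine sup_le (𝓥.adeleSpace_mono (by simp)) (Submodule.map_le_iff_le_comap.2 fun x hx => ?_)
    simpa [single_mem_adeleSpace] using hx

theorem relLength_adeleSpace_add_single (hf : 𝓥.FiniteResidue) (D : ι →₀ ℤ) (P : ι) (e : ℕ) :
    relLength (𝓥.adeleSpace D) (𝓥.adeleSpace (D + .single P (e : ℤ))) =
      (e * 𝓥.resDegree P : ℕ) := by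
  classical
  have hinf : 𝓥.adeleSpace D ⊓ (𝓥.localIdeal P (D P + e)).map (LinearMap.single k (fun _ => F) P) =
      (𝓥.localIdeal P (D P)).map (LinearMap.single k (fun _ => F) P) := by
    ext α
    constructor
    · rintro ⟨hα, x, -, rfl⟩
      exact ⟨x, single_mem_adeleSpace.1 hα, rfl⟩
    · rintro ⟨x, hx, rfl⟩
      exact ⟨single_mem_adeleSpace.2 hx, x, 𝓥.localIdeal_mono P (by omega) hx, rfl⟩
  rw [adeleSpace_add_single, relLength_sup, ← relLength_inf_right, hinf,
    relLength_map (LinearMap.ker_eq_bot.1 (LinearMap.ker_single ..)), relLength_localIdeal hf]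

theorem relLength_adeleSpace_add (hf : 𝓥.FiniteResidue) {E : ι →₀ ℤ} (hE : 0 ≤ E)
    (D : ι →₀ ℤ) :
    relLength (𝓥.adeleSpace D) (𝓥.adeleSpace (D + E)) = (𝓥.degree E).toNat := by
  induction E using Finsupp.induction generalizing D with
  | zero => simp [relLength_eq_zero]
  | single_add P n E hP _ ih =>
    have hn : 0 ≤ n := by simpa [Finsupp.notMem_support_iff.1 hP] using hE P
    have hE' : 0 ≤ E := fun Q => by
      rcases eq_or_ne Q P with rfl | hQ
      · simp [Finsupp.notMem_support_iff.1 hP]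
      · simpa [Finsupp.single_eq_of_ne hQ] using hE Q
    lift n to ℕ using hn
    rw [← add_assoc, relLength_trans (𝓥.adeleSpace_mono (by simp)) (𝓥.adeleSpace_mono
      (le_add_of_nonneg_right hE')), ih hE', relLength_adeleSpace_add_single hf, map_add,
      degree_single, Int.toNat_add (by positivity) (𝓥.degree_nonneg hE'), ← Nat.cast_mul,
      Int.toNat_natCast, Nat.cast_add]

theorem relLength_adeleSpace (hf : 𝓥.FiniteResidue) {D D' : ι →₀ ℤ} (hD : D ≤ D') :
    relLength (𝓥.adeleSpace D) (𝓥.adeleSpace D') = (𝓥.degree (D' - D)).toNat := by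
  simpa using relLength_adeleSpace_add hf (sub_nonneg.2 hD) D

end AdeleSpace

section RiemannRochSpace

variable (𝓥 : PlaceFamily k F ι)

/-- The diagonal embedding of the rational functions into the families of functions. -/
def diag (k F ι : Type*) [Field k] [Field F] [Algebra k F] : F →ₗ[k] (ι → F) :=
  LinearMap.pi fun _ => LinearMap.id

@[simp]
theorem diag_apply (f : F) (P : ι) : diag k F ι f P = f := rfl

theorem diag_injective [Nonempty ι] : Function.Injective (diag k F ι) :=
  fun _ _ h => congrFun h (Classical.arbitrary ι)

/-- The Riemann–Roch space `L(D)` of the rational functions with poles bounded by `D`. -/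
def riemannRochSpace (D : ι →₀ ℤ) : Submodule k F :=
  (𝓥.adeleSpace D).comap (diag k F ι)

/-- The space `𝔸(D) + F`. -/
def adeleSpaceSupDiag (D : ι →₀ ℤ) : Submodule k (ι → F) :=
  𝓥.adeleSpace D ⊔ LinearMap.range (diag k F ι)

theorem riemannRochSpace_mono : Monotone 𝓥.riemannRochSpace :=
  fun _ _ h => Submodule.comap_mono (𝓥.adeleSpace_mono h)

variable {𝓥}

theorem mul_mem_adeleSpace {D E : ι →₀ ℤ} {f : F} {α : ι → F} (hf : f ∈ 𝓥.riemannRochSpace D)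
    (hα : α ∈ 𝓥.adeleSpace E) : (fun P => f * α P) ∈ 𝓥.adeleSpace (D + E) := fun P => by
  rw [map_mul, Finsupp.add_apply, exp_add]
  exact mul_le_mul' (hf P) (hα P)

theorem mul_mem_riemannRochSpace_add {D E : ι →₀ ℤ} {f g : F} (hf : f ∈ 𝓥.riemannRochSpace D)
    (hg : g ∈ 𝓥.riemannRochSpace E) : f * g ∈ 𝓥.riemannRochSpace (D + E) :=
  mul_mem_adeleSpace hf hg

theorem one_mem_riemannRochSpace_zero : 1 ∈ 𝓥.riemannRochSpace 0 := fun P => by simp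

theorem pow_mem_riemannRochSpace_nsmul {D : ι →₀ ℤ} {f : F} (hf : f ∈ 𝓥.riemannRochSpace D)
    (n : ℕ) : f ^ n ∈ 𝓥.riemannRochSpace (n • D) := by
  induction n with
  | zero => simpa using one_mem_riemannRochSpace_zero
  | succ n ih =>
    rw [pow_succ, succ_nsmul]
    exact mul_mem_riemannRochSpace_add ih hf

theorem toNat_degree_sub_eq [Nonempty ι] (hf : 𝓥.FiniteResidue) {D D' : ι →₀ ℤ} (hD : D ≤ D') :
    ((𝓥.degree (D' - D)).toNat : ℕ∞) =
      relLength (𝓥.riemannRochSpace D) (𝓥.riemannRochSpace D') +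
        relLength (𝓥.adeleSpaceSupDiag D) (𝓥.adeleSpaceSupDiag D') := by
  rw [← relLength_adeleSpace hf hD, riemannRochSpace, riemannRochSpace,
    relLength_comap diag_injective]
  exact relLength_eq_inf_add_sup (𝓥.adeleSpace_mono hD) _

end RiemannRochSpace

end PlaceFamily

/-! ### Weak approximation -/

namespace PlaceFamily

variable {k F ι : Type*} [Field k] [Field F] [Algebra k F]

/-- The absolute value `2 ^ n` for a pole of order `n`; the base plays no role. -/
noncomputable def absVal (𝓥 : PlaceFamily k F ι) (P : ι) : AbsoluteValue F ℝ where
  toFun x := WithZeroMulInt.toNNReal two_ne_zero (𝓥.v P x)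
  map_mul' x y := by simp
  nonneg' x := NNReal.coe_nonneg _
  eq_zero' x := by simp
  add_le' x y := by
    have hmono := (WithZeroMulInt.toNNReal_strictMono (one_lt_two : (1 : NNReal) < 2)).monotone
    calc (WithZeroMulInt.toNNReal two_ne_zero (𝓥.v P (x + y)) : ℝ)
        ≤ WithZeroMulInt.toNNReal two_ne_zero (max (𝓥.v P x) (𝓥.v P y)) :=
          NNReal.coe_le_coe.2 (hmono ((𝓥.v P).map_add x y))
      _ ≤ _ := by
          rw [hmono.map_max, ← NNReal.coe_add, NNReal.coe_le_coe]
          exact max_le_add_of_nonneg zero_le zero_le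

/-- No valuation ring of the family is contained in another one. -/
def Independent (𝓥 : PlaceFamily k F ι) : Prop :=
  Pairwise fun P Q => ∃ x, 𝓥.v P x ≤ 1 ∧ 1 < 𝓥.v Q x

variable {𝓥 : PlaceFamily k F ι}

theorem absVal_le_absVal_iff {P : ι} {x y : F} :
    𝓥.absVal P x ≤ 𝓥.absVal P y ↔ 𝓥.v P x ≤ 𝓥.v P y :=
  NNReal.coe_le_coe.trans (WithZeroMulInt.toNNReal_strictMono one_lt_two).le_iff_le

theorem absVal_isNontrivial (P : ι) : (𝓥.absVal P).IsNontrivial := by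
  obtain ⟨t, ht, hv⟩ := 𝓥.exists_eq_exp P 1
  refine ⟨t, ht, fun h => ?_⟩
  have hle := absVal_le_absVal_iff.1 (h.trans (map_one (𝓥.absVal P)).symm).le
  rw [hv, map_one, ← exp_zero, exp_le_exp] at hle
  omega

theorem Independent.not_isEquiv_absVal (h : 𝓥.Independent) {P Q : ι} (hPQ : P ≠ Q) :
    ¬(𝓥.absVal P).IsEquiv (𝓥.absVal Q) := fun heq => by
  obtain ⟨x, hP, hQ⟩ := h hPQ
  have hle := heq x 1
  rw [absVal_le_absVal_iff, absVal_le_absVal_iff, map_one, map_one] at hle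
  exact hQ.not_ge (hle.1 hP)

theorem Independent.exists_forall_sub_le [Finite ι] (h : 𝓥.Independent) (D : ι → ℤ)
    (α : ι → F) : ∃ f, ∀ P, 𝓥.v P (α P - f) ≤ exp (D P) := by
  cases nonempty_fintype ι
  choose t ht0 ht using fun P => 𝓥.exists_eq_exp P (D P)
  let U : Set ((P : ι) → WithAbs (𝓥.absVal P)) :=
    Set.univ.pi fun P => Metric.ball (WithAbs.toAbs _ (α P)) (𝓥.absVal P (t P))
  have hU : IsOpen U := isOpen_set_pi Set.finite_univ fun _ _ => Metric.isOpen_ball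
  obtain ⟨f, hf⟩ := (AbsoluteValue.denseRange_algebraMap_pi 𝓥.absVal_isNontrivial
    fun _ _ => h.not_isEquiv_absVal).exists_mem_open hU
      ⟨fun P => WithAbs.toAbs _ (α P), fun P _ => Metric.mem_ball_self ((𝓥.absVal P).pos (ht0 P))⟩
  refine ⟨f, fun P => ?_⟩
  rw [← ht, ← absVal_le_absVal_iff]
  have hP : dist (WithAbs.toAbs (𝓥.absVal P) f) (WithAbs.toAbs _ (α P)) < 𝓥.absVal P (t P) :=
    hf P (Set.mem_univ P)
  rw [dist_comm, dist_eq_norm] at hP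
  exact hP.le

theorem Independent.adeleSpaceSupDiag_eq_top [Finite ι] (h : 𝓥.Independent) (D : ι →₀ ℤ) :
    𝓥.adeleSpaceSupDiag D = ⊤ := by
  refine eq_top_iff.2 fun α _ => ?_
  obtain ⟨f, hf⟩ := h.exists_forall_sub_le D α
  rw [← sub_add_cancel α (diag k F ι f)]
  exact Submodule.add_mem_sup hf ⟨f, rfl⟩

end PlaceFamily

/-! ### Zeros of a function -/

section AdjoinSingleton

open IntermediateField.algebraAdjoinAdjoin Polynomial

variable {k F : Type*} [Field k] [Field F] [Algebra k F]

theorem aeval_mul_mem {B : Submodule k F} {y : F} (hB : ∀ x ∈ B, y * x ∈ B) (p : k[X]) {x : F}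
    (hx : x ∈ B) : aeval y p * x ∈ B := by
  induction p using Polynomial.induction_on' generalizing x with
  | add p q hp hq =>
    rw [map_add, add_mul]
    exact B.add_mem (hp hx) (hq hx)
  | monomial n c =>
    rw [aeval_monomial, ← Algebra.smul_def, smul_mul_assoc]
    refine B.smul_mem c ?_
    induction n with
    | zero => simpa using hx
    | succ n ih =>
      rw [pow_succ', mul_assoc]
      exact hB _ ih

theorem eq_zero_of_sum_aeval_mul_eq_zero {κ : Type*} {B : Submodule k F} {y : F} (hy : y ≠ 0)
    (hB : ∀ x ∈ B, y * x ∈ B) {b : κ → B}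
    (hb : LinearIndependent k (((B.map (LinearMap.mulLeft k y)).submoduleOf B).mkQ ∘ b))
    (s : Finset κ) (n : ℕ) {p : κ → k[X]} (hp : ∀ j ∈ s, (p j).degree < n)
    (hsum : ∑ j ∈ s, aeval y (p j) * (b j : F) = 0) : ∀ j ∈ s, p j = 0 := by
  induction n generalizing p with
  | zero => simpa [degree_lt_iff_coeff_zero, Polynomial.ext_iff] using hp
  | succ n ih =>
    -- Compare the terms modulo `y B`, then divide by `y`.
    have hdecomp : ∑ j ∈ s, (p j).coeff 0 • (b j : F) +
        y * ∑ j ∈ s, aeval y (p j).divX * (b j : F) = 0 := by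
      rw [← hsum, Finset.mul_sum, ← Finset.sum_add_distrib]
      refine Finset.sum_congr rfl fun j _ => ?_
      conv_rhs => rw [← divX_mul_X_add (p j)]
      simp only [map_add, map_mul, aeval_X, aeval_C, Algebra.smul_def]
      ring
    have hcoeff : ∀ j ∈ s, (p j).coeff 0 = 0 := by
      refine linearIndependent_iff'.1 hb s _ ?_
      have hmem : ∑ j ∈ s, (p j).coeff 0 • b j ∈
          (B.map (LinearMap.mulLeft k y)).submoduleOf B := by
        refine ⟨-∑ j ∈ s, aeval y (p j).divX * (b j : F),
          neg_mem (sum_mem fun j _ => aeval_mul_mem hB _ (b j).2), ?_⟩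
        simp only [LinearMap.mulLeft_apply, map_sum, map_smul, Submodule.subtype_apply]
        linear_combination -hdecomp
      simpa only [← Submodule.mkQ_apply, map_sum, map_smul, Function.comp_apply] using
        (Submodule.Quotient.mk_eq_zero _).2 hmem
    have hdivX : ∀ j ∈ s, (p j).divX = 0 := by
      refine ih (fun j hj => ?_) ?_
      · rw [degree_lt_iff_coeff_zero]
        intro m hm
        rw [coeff_divX]
        exact (degree_lt_iff_coeff_zero _ _).1 (hp j hj) _ (by omega)
      · rw [Finset.sum_congr rfl fun j hj => by rw [hcoeff j hj, zero_smul],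
          Finset.sum_const_zero, zero_add] at hdecomp
        exact (mul_eq_zero.1 hdecomp).resolve_left hy
    intro j hj
    rw [← divX_mul_X_add (p j), hdivX j hj, hcoeff j hj]
    simp

theorem linearIndependent_adjoin_singleton {κ : Type*} {B : Submodule k F} {y : F} (hy : y ≠ 0)
    (hB : ∀ x ∈ B, y * x ∈ B) {b : κ → B}
    (hb : LinearIndependent k (((B.map (LinearMap.mulLeft k y)).submoduleOf B).mkQ ∘ b)) :
    LinearIndependent (IntermediateField.adjoin k {y}) fun j => (b j : F) := by
  rw [← LinearIndependent.iff_fractionRing (Algebra.adjoin k {y}), linearIndependent_iff']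
  intro s g hg j hj
  have hmem : ∀ j, ∃ p : k[X], aeval y p = (g j : F) := fun j =>
    (Algebra.adjoin_singleton_eq_range_aeval k y).le (g j).2
  choose p hp using hmem
  have hp0 := eq_zero_of_sum_aeval_mul_eq_zero hy hB hb s (s.sup (fun j => (p j).natDegree) + 1)
    (fun j hj => degree_le_natDegree.trans_lt (Nat.cast_lt.2
      (Nat.lt_succ_of_le (Finset.le_sup (f := fun j => (p j).natDegree) hj))))
    ((Finset.sum_congr rfl fun j _ => by rw [hp, Algebra.smul_def]; rfl).trans hg) j hj
  ext
  rw [← hp, hp0, map_zero]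
  rfl

theorem relLength_map_mulLeft_le_finrank {B : Submodule k F} {y : F} (hy : y ≠ 0)
    (hB : ∀ x ∈ B, y * x ∈ B) [FiniteDimensional (IntermediateField.adjoin k {y}) F] :
    relLength (B.map (LinearMap.mulLeft k y)) B ≤
      Module.finrank (IntermediateField.adjoin k {y}) F := by
  let A := (B.map (LinearMap.mulLeft k y)).submoduleOf B
  let β := Module.Free.chooseBasis k (B ⧸ A)
  choose b hb using fun j => A.mkQ_surjective (β j)
  have hli := linearIndependent_adjoin_singleton hy hB (b := b)
    (by convert β.linearIndependent using 1; exact funext hb)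
  have hfin : Finite (Module.Free.ChooseBasisIndex k (B ⧸ A)) := hli.finite
  cases nonempty_fintype (Module.Free.ChooseBasisIndex k (B ⧸ A))
  have : Module.Finite k (B ⧸ A) := .of_basis β
  rw [relLength, Module.length_eq_finrank, Module.finrank_eq_card_basis β, Nat.cast_le]
  exact hli.fintype_card_le_finrank

end AdjoinSingleton

namespace PlaceFamily

variable {k F ι : Type*} [Field k] [Field F] [Algebra k F] {𝓥 : PlaceFamily k F ι}

theorem map_mulLeft_riemannRochSpace {y : F} (hy0 : y ≠ 0) {E : ι →₀ ℤ}
    (hy : ∀ P, 𝓥.v P y = exp (E P)) (D : ι →₀ ℤ) :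
    (𝓥.riemannRochSpace D).map (LinearMap.mulLeft k y) = 𝓥.riemannRochSpace (E + D) := by
  have hmul {E : ι →₀ ℤ} {y : F} (hy : ∀ P, 𝓥.v P y = exp (E P)) {D : ι →₀ ℤ} {x : F}
      (hx : x ∈ 𝓥.riemannRochSpace D) : y * x ∈ 𝓥.riemannRochSpace (E + D) :=
    mul_mem_riemannRochSpace_add (fun P => (hy P).le) hx
  apply le_antisymm
  · rintro _ ⟨x, hx, rfl⟩
    exact hmul hy hx
  · intro x hx
    refine ⟨y⁻¹ * x, ?_, mul_inv_cancel_left₀ hy0 x⟩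
    rw [← neg_add_cancel_left E D]
    exact hmul (fun P => by rw [map_inv₀, hy, Finsupp.neg_apply, exp_neg]) hx

theorem Independent.degree_zeros_le_finrank [Finite ι] (h : 𝓥.Independent)
    (hf : 𝓥.FiniteResidue) {y : F} {E : ι →₀ ℤ} (hE : 0 ≤ E) (hy : ∀ P, 𝓥.v P y = exp (-E P))
    [FiniteDimensional (IntermediateField.adjoin k {y}) F] :
    𝓥.degree E ≤ Module.finrank (IntermediateField.adjoin k {y}) F := by
  rcases isEmpty_or_nonempty ι with _ | ⟨⟨P₀⟩⟩
  · simp [Subsingleton.elim E 0]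
  have : Nonempty ι := ⟨P₀⟩
  have hy0 : y ≠ 0 := by
    rintro rfl
    exact exp_ne_zero ((hy P₀).symm.trans (map_zero _))
  have hy' : ∀ P, 𝓥.v P y = exp ((-E) P) := hy
  have hmap := map_mulLeft_riemannRochSpace hy0 hy' 0
  rw [add_zero] at hmap
  have hstable : ∀ x ∈ 𝓥.riemannRochSpace 0, y * x ∈ 𝓥.riemannRochSpace 0 := fun x hx =>
    𝓥.riemannRochSpace_mono (neg_nonpos.2 hE) (hmap ▸ Submodule.mem_map_of_mem hx)
  have hlength := toNat_degree_sub_eq hf (neg_nonpos.2 hE)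
  rw [h.adeleSpaceSupDiag_eq_top, h.adeleSpaceSupDiag_eq_top, relLength_eq_zero.2 le_rfl,
    add_zero, ← hmap, zero_sub, neg_neg] at hlength
  have hle := relLength_map_mulLeft_le_finrank hy0 hstable
  rw [← hlength, Nat.cast_le] at hle
  exact Int.toNat_le.1 hle

end PlaceFamily

/-! ### Principal divisors -/

theorem valuation_le_one_of_isIntegral {A F Γ : Type*} [CommRing A] [Field F] [Algebra A F]
    [LinearOrderedCommGroupWithZero Γ] {v : Valuation F Γ} (h : ∀ a, v (algebraMap A F a) ≤ 1)
    {x : F} (hx : IsIntegral A x) : v x ≤ 1 := by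
  obtain ⟨p, hp, hpx⟩ := hx
  let φ : A →+* v.integer := (algebraMap A F).codRestrict v.integer h
  refine (Valuation.integer.integers v).mem_of_integral ⟨p.map φ, hp.map φ, ?_⟩
  rw [Polynomial.eval₂_map]
  exact hpx

theorem adjoin_simple_inv {k F : Type*} [Field k] [Field F] [Algebra k F] (x : F) :
    IntermediateField.adjoin k {x⁻¹} = IntermediateField.adjoin k {x} := by
  apply le_antisymm <;> rw [IntermediateField.adjoin_simple_le_iff]
  · exact inv_mem (IntermediateField.mem_adjoin_simple_self k x)
  · exact inv_mem_iff.1 (IntermediateField.mem_adjoin_simple_self k x⁻¹)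

namespace PlaceFamily

variable {k F ι : Type*} [Field k] [Field F] [Algebra k F] {𝓥 : PlaceFamily k F ι}

theorem map_le_one_of_isAlgebraic {x : F} (hx : IsAlgebraic k x) (P : ι) : 𝓥.v P x ≤ 1 :=
  valuation_le_one_of_isIntegral (𝓥.map_const_le_one P) hx.isIntegral

theorem map_eq_one_of_isAlgebraic {x : F} (hx : IsAlgebraic k x) (hx0 : x ≠ 0) (P : ι) :
    𝓥.v P x = 1 := by
  apply le_antisymm (map_le_one_of_isAlgebraic hx P)
  have hinv := 𝓥.map_le_one_of_isAlgebraic hx.inv P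
  rwa [map_inv₀, inv_le_one₀ (by simpa [zero_lt_iff] using hx0)] at hinv

theorem exists_transcendental [Nonempty ι] (𝓥 : PlaceFamily k F ι) :
    ∃ x : F, Transcendental k x := by
  obtain ⟨t, ht, hv⟩ := 𝓥.exists_eq_exp (Classical.arbitrary ι) 1
  refine ⟨t, fun halg => ?_⟩
  rw [map_eq_one_of_isAlgebraic halg ht, eq_comm, exp_eq_one] at hv
  exact one_ne_zero hv

/-- The subfamily of the places in a given set. -/
def restrict (𝓥 : PlaceFamily k F ι) (S : Set ι) : PlaceFamily k F S where
  v P := 𝓥.v P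
  map_const_le_one P := 𝓥.map_const_le_one P
  surjective P := 𝓥.surjective P

/-- The family of all places of a function field `F` of one variable over `k`. Completeness is
expressed by the existence of poles. -/
structure IsComplete (𝓥 : PlaceFamily k F ι) : Prop where
  finiteResidue : 𝓥.FiniteResidue
  independent : 𝓥.Independent
  finite_adjoin : ∀ x : F, Transcendental k x →
    FiniteDimensional (IntermediateField.adjoin k {x}) F
  exists_pole : ∀ x : F, Transcendental k x → ∃ P, 1 < 𝓥.v P x

namespace IsComplete

variable (h : 𝓥.IsComplete)
include h

theorem sum_log_mul_resDegree_le {x : F} (hx : Transcendental k x) {S : Finset ι}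
    (hS : ∀ P ∈ S, 1 < 𝓥.v P x) :
    ∑ P ∈ S, log (𝓥.v P x) * 𝓥.resDegree P ≤
      Module.finrank (IntermediateField.adjoin k {x}) F := by
  have hfin := h.finite_adjoin x hx
  rw [← adjoin_simple_inv] at hfin ⊢
  let E : S →₀ ℤ := Finsupp.equivFunOnFinite.symm fun P => log (𝓥.v P x)
  have hE : 0 ≤ E := fun P => by
    simpa [E] using (log_le_log one_ne_zero (zero_lt_one.trans (hS P P.2)).ne').2 (hS P P.2).le
  have hindep : (𝓥.restrict S).Independent := fun P Q hPQ =>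
    h.independent fun heq => hPQ (Subtype.ext heq)
  have hdegree := hindep.degree_zeros_le_finrank (fun P => h.finiteResidue P) hE (y := x⁻¹)
    fun P => by
      change 𝓥.v P x⁻¹ = exp (-log (𝓥.v P x))
      rw [map_inv₀, exp_neg, exp_log (zero_lt_one.trans (hS P P.2)).ne']
  rw [degree_eq_sum, Finsupp.sum_fintype _ _ (by simp)] at hdegree
  exact (Finset.sum_coe_sort S fun P => log (𝓥.v P x) * (𝓥.resDegree P : ℤ)).symm.trans_le hdegree

theorem finite_poles (x : F) : {P | 1 < 𝓥.v P x}.Finite := by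
  by_cases hx : Transcendental k x
  · by_contra hinf
    obtain ⟨S, hS, hcard⟩ := Set.Infinite.exists_subset_card_eq hinf
      (Module.finrank (IntermediateField.adjoin k {x}) F + 1)
    have hone : ∀ P ∈ S, (1 : ℤ) ≤ log (𝓥.v P x) * 𝓥.resDegree P := fun P hP =>
      Int.mul_pos ((lt_log_iff_exp_lt (zero_lt_one.trans (hS hP)).ne').2 (hS hP))
        (Nat.cast_pos.2 (resDegree_pos h.finiteResidue P))
    have hle := (S.card_nsmul_le_sum _ _ hone).trans (h.sum_log_mul_resDegree_le hx fun P => @hS P)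
    rw [hcard, nsmul_one] at hle
    omega
  · convert Set.finite_empty
    ext P
    simpa using map_le_one_of_isAlgebraic (not_not.1 hx) P

/-- The divisor of zeros minus poles of `f`, with the convention that it is `0` for `f = 0`. -/
noncomputable def principalDivisor (f : F) : ι →₀ ℤ :=
  Finsupp.ofSupportFinite (fun P => -log (𝓥.v P f)) <| by
    refine ((h.finite_poles f).union (h.finite_poles f⁻¹)).subset fun P hP => ?_
    rcases eq_or_ne f 0 with rfl | hf
    · simp at hP
    have hv : 𝓥.v P f ≠ 0 := (Valuation.ne_zero_iff _).2 hf
    have hne : 𝓥.v P f ≠ 1 := fun h1 => by simp [h1] at hP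
    rcases hne.lt_or_gt with hlt | hgt
    · exact .inr (by simpa using (one_lt_inv₀ (zero_lt_iff.2 hv)).2 hlt)
    · exact .inl hgt

@[simp]
theorem principalDivisor_apply (f : F) (P : ι) : h.principalDivisor f P = -log (𝓥.v P f) := rfl

theorem principalDivisor_inv (f : F) : h.principalDivisor f⁻¹ = -h.principalDivisor f := by
  ext P
  simp

theorem map_eq_exp_neg_principalDivisor {f : F} (hf : f ≠ 0) (P : ι) :
    𝓥.v P f = exp ((-h.principalDivisor f) P) := by
  simp [exp_log, hf]

theorem mem_riemannRochSpace_iff_neg_le {f : F} (hf : f ≠ 0) {D : ι →₀ ℤ} :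
    f ∈ 𝓥.riemannRochSpace D ↔ -h.principalDivisor f ≤ D :=
  forall_congr' fun P => by
    rw [diag_apply, h.map_eq_exp_neg_principalDivisor hf, exp_le_exp]

theorem principalDivisor_eq_zero_of_isAlgebraic {f : F} (hf : IsAlgebraic k f) :
    h.principalDivisor f = 0 := by
  ext P
  rcases eq_or_ne f 0 with rfl | hf0
  · simp
  · simp [map_eq_one_of_isAlgebraic (𝓥 := 𝓥) hf hf0 P]

/-- The divisor of poles of a function. -/
noncomputable def poleDivisor (f : F) : ι →₀ ℤ := (h.principalDivisor f)⁻

theorem poleDivisor_nonneg (f : F) : 0 ≤ h.poleDivisor f := negPart_nonneg _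

theorem principalDivisor_eq_sub (f : F) :
    h.principalDivisor f = h.poleDivisor f⁻¹ - h.poleDivisor f := by
  rw [poleDivisor, poleDivisor, principalDivisor_inv, negPart_neg, posPart_sub_negPart]

theorem mem_riemannRochSpace_poleDivisor (f : F) :
    f ∈ 𝓥.riemannRochSpace (h.poleDivisor f) := by
  rcases eq_or_ne f 0 with rfl | hf
  · exact zero_mem _
  · exact (h.mem_riemannRochSpace_iff_neg_le hf).2 (neg_le_negPart _)

theorem poleDivisor_apply (f : F) (P : ι) : h.poleDivisor f P = log (𝓥.v P f) ⊔ 0 := by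
  rw [poleDivisor, negPart_def, Finsupp.sup_apply, Finsupp.neg_apply, principalDivisor_apply,
    neg_neg, Finsupp.zero_apply]

theorem poleDivisor_apply_pos_iff {f : F} {P : ι} : 0 < h.poleDivisor f P ↔ 1 < 𝓥.v P f := by
  rcases eq_or_ne f 0 with rfl | hf
  · simp [poleDivisor_apply]
  rw [poleDivisor_apply, lt_sup_iff, or_iff_left (lt_irrefl 0),
    lt_log_iff_exp_lt ((Valuation.ne_zero_iff _).2 hf), exp_zero]

theorem degree_poleDivisor_le {x : F} (hx : Transcendental k x) :
    𝓥.degree (h.poleDivisor x) ≤ Module.finrank (IntermediateField.adjoin k {x}) F := by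
  have hpole : ∀ P ∈ (h.poleDivisor x).support, 1 < 𝓥.v P x := fun P hP =>
    h.poleDivisor_apply_pos_iff.1
      ((h.poleDivisor_nonneg x P).lt_of_ne' (Finsupp.mem_support_iff.1 hP))
  refine le_of_eq_of_le (Finset.sum_congr rfl fun P hP => ?_) (h.sum_log_mul_resDegree_le hx hpole)
  have hlog : 0 ≤ log (𝓥.v P x) :=
    ((lt_log_iff_exp_lt (zero_lt_one.trans (hpole P hP)).ne').2 (hpole P hP)).le
  rw [poleDivisor_apply, sup_eq_left.2 hlog]
  rfl

theorem mem_riemannRochSpace_zero_iff {x : F} : x ∈ 𝓥.riemannRochSpace 0 ↔ IsAlgebraic k x := by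
  refine ⟨fun hx => ?_, fun hx P => map_le_one_of_isAlgebraic hx P⟩
  by_contra htrans
  obtain ⟨P, hP⟩ := h.exists_pole x htrans
  exact (hx P).not_gt hP

theorem length_riemannRochSpace_zero_le (P : ι) :
    Module.length k (𝓥.riemannRochSpace 0) ≤ 𝓥.resDegree P := by
  have hinf : 𝓥.localIdeal P (-1) ⊓ 𝓥.riemannRochSpace 0 = ⊥ := by
    refine (Submodule.eq_bot_iff _).2 fun x hx => ?_
    by_contra hx0
    have hle : 𝓥.v P x ≤ exp (-1) := hx.1
    rw [map_eq_one_of_isAlgebraic (h.mem_riemannRochSpace_zero_iff.1 hx.2) hx0, ← exp_zero,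
      exp_le_exp] at hle
    omega
  rw [← relLength_bot, ← hinf, relLength_inf_right, resDegree,
    ENat.natCast_toNat (h.finiteResidue P)]
  exact relLength_mono_right fun x hx => hx P

end IsComplete

end PlaceFamily

/-! ### Riemann's inequality -/

theorem linearIndependent_pow_of_transcendental {R A : Type*} [CommRing R] [Ring A] [Algebra R A]
    {x : A} (hx : Transcendental R x) : LinearIndependent R fun n : ℕ => x ^ n := by
  have hmap := (Polynomial.basisMonomials R).linearIndependent.map_injOn
    (Polynomial.aeval x).toLinearMap (transcendental_iff_injective.1 hx).injOn
  simpa [Function.comp_def] using hmap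

namespace PlaceFamily

variable {k F ι : Type*} [Field k] [Field F] [Algebra k F] {𝓥 : PlaceFamily k F ι}

/-- The dimension of the Riemann–Roch space of `D`. -/
noncomputable def ell (𝓥 : PlaceFamily k F ι) (D : ι →₀ ℤ) : ℕ :=
  Module.finrank k (𝓥.riemannRochSpace D)

/-- The defect `deg D - ℓ(D)`. Riemann's inequality bounds it from above, and its maximum is one
less than the genus. -/
noncomputable def defect (𝓥 : PlaceFamily k F ι) (D : ι →₀ ℤ) : ℤ :=
  𝓥.degree D - 𝓥.ell D

namespace IsComplete

variable (h : 𝓥.IsComplete)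
include h

theorem ell_sub_principalDivisor {f : F} (hf : f ≠ 0) (D : ι →₀ ℤ) :
    𝓥.ell (D - h.principalDivisor f) = 𝓥.ell D := by
  rw [ell, sub_eq_neg_add,
    ← map_mulLeft_riemannRochSpace hf (h.map_eq_exp_neg_principalDivisor hf) D]
  exact (Submodule.equivMapOfInjective _ (mul_right_injective₀ hf) _).finrank_eq.symm

theorem exists_poleDivisor_le_nsmul {x y : F} (hy : IsIntegral (Algebra.adjoin k {x}) y) :
    ∃ m : ℕ, h.poleDivisor y ≤ m • h.poleDivisor x := by
  have hpole : ∀ P, 1 < 𝓥.v P y → 1 < 𝓥.v P x := fun P => by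
    contrapose!
    refine fun hP => valuation_le_one_of_isIntegral (fun ⟨a, ha⟩ => ?_) hy
    change 𝓥.v P a ≤ 1
    induction ha using Algebra.adjoin_induction with
    | mem z hz => rwa [Set.mem_singleton_iff.1 hz]
    | algebraMap c => exact 𝓥.map_const_le_one P c
    | add y z _ _ hy hz => exact (𝓥.v P).map_add_le hy hz
    | mul y z _ _ hy hz => exact (map_mul (𝓥.v P) y z).trans_le (mul_le_one' hy hz)
  refine ⟨∑ P ∈ (h.poleDivisor y).support, (h.poleDivisor y P).toNat, fun P => ?_⟩
  rw [Finsupp.smul_apply, nsmul_eq_mul]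
  rcases (h.poleDivisor_nonneg y P).eq_or_lt' with hzero | hpos
  · exact hzero.trans_le (mul_nonneg (Nat.cast_nonneg _) (h.poleDivisor_nonneg x P))
  · have hx := h.poleDivisor_apply_pos_iff.2 (hpole P (h.poleDivisor_apply_pos_iff.1 hpos))
    have hle := Finset.single_le_sum (f := fun P => (h.poleDivisor y P).toNat)
      (fun _ _ => Nat.zero_le _) (Finsupp.mem_support_iff.2 hpos.ne')
    exact (Int.toNat_le.1 hle).trans (le_mul_of_one_le_right (Nat.cast_nonneg _) hx)

variable [Nonempty ι]

theorem relLength_riemannRochSpace_ne_top {D D' : ι →₀ ℤ} (hD : D ≤ D') :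
    relLength (𝓥.riemannRochSpace D) (𝓥.riemannRochSpace D') ≠ ⊤ :=
  ne_top_of_le_ne_top (ENat.natCast_ne_top _) (toNat_degree_sub_eq h.finiteResidue hD ▸ le_self_add)

theorem relLength_adeleSpaceSupDiag_ne_top {D D' : ι →₀ ℤ} (hD : D ≤ D') :
    relLength (𝓥.adeleSpaceSupDiag D) (𝓥.adeleSpaceSupDiag D') ≠ ⊤ :=
  ne_top_of_le_ne_top (ENat.natCast_ne_top _) (toNat_degree_sub_eq h.finiteResidue hD ▸ le_add_self)

theorem finite_riemannRochSpace (D : ι →₀ ℤ) : Module.Finite k (𝓥.riemannRochSpace D) := by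
  have hzero := h.length_riemannRochSpace_zero_le (Classical.arbitrary ι)
  have hle : relLength ⊥ (𝓥.riemannRochSpace D) ≤ relLength ⊥ (𝓥.riemannRochSpace (D ⊔ 0)) :=
    relLength_mono_right (𝓥.riemannRochSpace_mono le_sup_left)
  rw [relLength_trans bot_le (𝓥.riemannRochSpace_mono le_sup_right), relLength_bot,
    relLength_bot] at hle
  refine finite_of_length_ne_top (ne_top_of_le_ne_top (WithTop.add_ne_top.2 ⟨?_, ?_⟩) hle)
  · exact ne_top_of_le_ne_top (ENat.natCast_ne_top _) hzero
  · exact h.relLength_riemannRochSpace_ne_top le_sup_right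

theorem length_riemannRochSpace (D : ι →₀ ℤ) :
    Module.length k (𝓥.riemannRochSpace D) = 𝓥.ell D :=
  have := h.finite_riemannRochSpace D
  Module.length_eq_finrank k _

theorem defect_add_toNat_relLength {D D' : ι →₀ ℤ} (hD : D ≤ D') :
    𝓥.defect D + (relLength (𝓥.adeleSpaceSupDiag D) (𝓥.adeleSpaceSupDiag D')).toNat =
      𝓥.defect D' := by
  have hdegree := toNat_degree_sub_eq h.finiteResidue hD
  have hell := relLength_trans bot_le (𝓥.riemannRochSpace_mono hD)
  rw [relLength_bot, relLength_bot, h.length_riemannRochSpace, h.length_riemannRochSpace] at hell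
  lift relLength (𝓥.riemannRochSpace D) (𝓥.riemannRochSpace D') to ℕ
    using h.relLength_riemannRochSpace_ne_top hD with a
  lift relLength (𝓥.adeleSpaceSupDiag D) (𝓥.adeleSpaceSupDiag D') to ℕ
    using h.relLength_adeleSpaceSupDiag_ne_top hD with r
  have hmono := 𝓥.degree_mono hD
  norm_cast at hdegree hell
  rw [map_sub] at hdegree
  rw [defect, defect, ENat.toNat_natCast]
  omega

theorem defect_mono : Monotone 𝓥.defect := fun D D' hD => by
  have := h.defect_add_toNat_relLength hD
  omega

theorem exists_forall_finrank_mul_le {x : F} (hx : Transcendental k x) :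
    ∃ m₀ : ℕ, ∀ m : ℕ, Module.finrank (IntermediateField.adjoin k {x}) F * (m + 1) ≤
      𝓥.ell ((m + m₀) • h.poleDivisor x) := by
  have hfin := h.finite_adjoin x hx
  obtain ⟨s, b, hb⟩ := open IntermediateField.algebraAdjoinAdjoin in
    FiniteDimensional.exists_is_basis_integral (Algebra.adjoin k {x})
      (IntermediateField.adjoin k {x}) F
  choose n hn using fun j => h.exists_poleDivisor_le_nsmul (hb j)
  refine ⟨∑ j, n j, fun m => ?_⟩
  let B := h.poleDivisor x
  have hbmem : ∀ j, b j ∈ 𝓥.riemannRochSpace ((∑ j, n j) • B) := fun j =>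
    𝓥.riemannRochSpace_mono ((hn j).trans (nsmul_le_nsmul_left (h.poleDivisor_nonneg x)
      (Finset.single_le_sum (fun _ _ => Nat.zero_le _) (Finset.mem_univ j))))
      (h.mem_riemannRochSpace_poleDivisor (b j))
  -- The products of `1, x, …, x ^ m` with a basis of `F` over `k(x)` which is integral over `k[x]`.
  let a : Fin (m + 1) → IntermediateField.adjoin k {x} :=
    fun i => IntermediateField.AdjoinSimple.gen k x ^ (i : ℕ)
  have ha : LinearIndependent k a :=
    (linearIndependent_pow_of_transcendental ((transcendental_algebraMap_iff
      (algebraMap (IntermediateField.adjoin k {x}) F).injective).1 hx)).comp _ Fin.val_injective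
  have hmem : ∀ p : Fin (m + 1) × s, a p.1 • b p.2 ∈
      𝓥.riemannRochSpace ((m + ∑ j, n j) • B) := fun ⟨i, j⟩ => by
    have hpow := mul_mem_riemannRochSpace_add
      (pow_mem_riemannRochSpace_nsmul (h.mem_riemannRochSpace_poleDivisor x) i) (hbmem j)
    rw [← add_nsmul] at hpow
    exact 𝓥.riemannRochSpace_mono (nsmul_le_nsmul_left (h.poleDivisor_nonneg x)
      (Nat.add_le_add_right (Nat.lt_succ_iff.1 i.2) _)) hpow
  have hli : LinearIndependent k fun p =>
      (⟨a p.1 • b p.2, hmem p⟩ : 𝓥.riemannRochSpace ((m + ∑ j, n j) • B)) :=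
    .of_comp (Submodule.subtype _) (linearIndependent_smul ha b.linearIndependent)
  have := h.finite_riemannRochSpace ((m + ∑ j, n j) • B)
  have hcard := hli.fintype_card_le_finrank
  rwa [Fintype.card_prod, Fintype.card_fin, mul_comm, ← Module.finrank_eq_card_basis b] at hcard

theorem degree_poleDivisor {x : F} (hx : Transcendental k x) :
    𝓥.degree (h.poleDivisor x) = Module.finrank (IntermediateField.adjoin k {x}) F := by
  refine (h.degree_poleDivisor_le hx).antisymm ?_
  by_contra! hlt
  obtain ⟨m₀, hm₀⟩ := h.exists_forall_finrank_mul_le hx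
  set n := Module.finrank (IntermediateField.adjoin k {x}) F
  have hd := degree_nonneg (𝓥 := 𝓥) (h.poleDivisor_nonneg x)
  lift 𝓥.degree (h.poleDivisor x) to ℕ using hd with d hd_eq
  have hdefect := h.defect_mono
    (nsmul_nonneg (h.poleDivisor_nonneg x) (m₀ * d + 𝓥.ell 0 + m₀))
  rw [defect, defect, map_zero, map_nsmul, ← hd_eq, nsmul_eq_mul] at hdefect
  have hell := hm₀ (m₀ * d + 𝓥.ell 0)
  zify at hell
  push_cast at hdefect
  nlinarith

theorem degree_principalDivisor (f : F) : 𝓥.degree (h.principalDivisor f) = 0 := by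
  by_cases hf : Transcendental k f
  · have hf' : Transcendental k f⁻¹ := fun halg => hf (by simpa using halg.inv)
    rw [principalDivisor_eq_sub, map_sub, h.degree_poleDivisor hf, h.degree_poleDivisor hf',
      adjoin_simple_inv, sub_self]
  · rw [h.principalDivisor_eq_zero_of_isAlgebraic (not_not.1 hf), map_zero]

theorem defect_sub_principalDivisor {f : F} (hf : f ≠ 0) (D : ι →₀ ℤ) :
    𝓥.defect (D - h.principalDivisor f) = 𝓥.defect D := by
  rw [defect, defect, map_sub, h.degree_principalDivisor, h.ell_sub_principalDivisor hf, sub_zero]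

theorem exists_mem_riemannRochSpace_ne_zero {D : ι →₀ ℤ} (hD : 0 < 𝓥.ell D) :
    ∃ f ∈ 𝓥.riemannRochSpace D, f ≠ 0 := by
  have := h.finite_riemannRochSpace D
  obtain ⟨f, hf⟩ := Module.finrank_pos_iff_exists_ne_zero.1 hD
  exact ⟨f, f.2, fun h0 => hf (Subtype.ext h0)⟩

theorem exists_defect_nsmul_le {x : F} (hx : Transcendental k x) :
    ∃ c, ∀ m : ℕ, 𝓥.defect (m • h.poleDivisor x) ≤ c := by
  obtain ⟨m₀, hm₀⟩ := h.exists_forall_finrank_mul_le hx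
  refine ⟨Module.finrank (IntermediateField.adjoin k {x}) F * m₀, fun m => ?_⟩
  have hle := nsmul_le_nsmul_left (h.poleDivisor_nonneg x) (m.le_add_right m₀)
  refine (h.defect_mono hle).trans ?_
  have hell := hm₀ m
  zify at hell
  rw [defect, map_nsmul, h.degree_poleDivisor hx, nsmul_eq_mul]
  push_cast
  nlinarith

theorem exists_le_nsmul_sub_principalDivisor {x : F} (hx : Transcendental k x) (D : ι →₀ ℤ) :
    ∃ m : ℕ, ∃ f ≠ 0, D ≤ m • h.poleDivisor x - h.principalDivisor f := by
  have hfin := h.finite_adjoin x hx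
  obtain ⟨c, hc⟩ := h.exists_defect_nsmul_le hx
  have hn : (1 : ℤ) ≤ 𝓥.degree (h.poleDivisor x) := by
    rw [h.degree_poleDivisor hx]
    exact Nat.one_le_cast.2 Module.finrank_pos
  let m := (𝓥.degree D⁺ + c + 1).toNat
  have hdefect :=
    (h.defect_mono (sub_le_self (m • h.poleDivisor x) (posPart_nonneg D))).trans (hc m)
  rw [defect, map_sub, map_nsmul, nsmul_eq_mul] at hdefect
  have hm : 𝓥.degree D⁺ + c + 1 ≤ m := Int.self_le_toNat _
  have hpos : 0 < 𝓥.ell (m • h.poleDivisor x - D⁺) := by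
    zify
    nlinarith
  obtain ⟨f, hf, hf0⟩ := h.exists_mem_riemannRochSpace_ne_zero hpos
  refine ⟨m, f⁻¹, inv_ne_zero hf0, ?_⟩
  rw [principalDivisor_inv, sub_neg_eq_add]
  have hle := (h.mem_riemannRochSpace_iff_neg_le hf0).1 hf
  exact (le_posPart D).trans (by rwa [neg_le, neg_sub, sub_le_iff_le_add'] at hle)

theorem exists_forall_defect_le : ∃ c, ∀ D, 𝓥.defect D ≤ c := by
  obtain ⟨x, hx⟩ := exists_transcendental 𝓥
  obtain ⟨c, hc⟩ := h.exists_defect_nsmul_le hx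
  refine ⟨c, fun D => ?_⟩
  obtain ⟨m, f, hf, hle⟩ := h.exists_le_nsmul_sub_principalDivisor hx D
  exact (h.defect_mono hle).trans ((h.defect_sub_principalDivisor hf _).trans_le (hc m))

end IsComplete

end PlaceFamily

/-! ### The Riemann–Roch theorem -/

namespace PlaceFamily

variable {k F ι : Type*} [Field k] [Field F] [Algebra k F]

section Adeles

variable (𝓥 : PlaceFamily k F ι)

/-- The adeles (repartitions): families of functions which are regular at almost all places. -/
def adeles : Submodule k (ι → F) where
  carrier := {α | ∀ᶠ P in Filter.cofinite, 𝓥.v P (α P) ≤ 1}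
  zero_mem' := by simp
  add_mem' ha hb := by
    filter_upwards [Set.mem_ofPred.1 ha, Set.mem_ofPred.1 hb] with P using (𝓥.v P).map_add_le
  smul_mem' c _ ha := by
    filter_upwards [Set.mem_ofPred.1 ha] with P using (𝓥.map_smul_le P c _).trans

theorem adeleSpace_le_adeles (D : ι →₀ ℤ) : 𝓥.adeleSpace D ≤ 𝓥.adeles := fun α hα =>
  D.hasFiniteSupport.subset fun P hP hzero => hP (by simpa [hzero] using hα P)

/-- The Weil differentials with divisor at least `D`. -/
def weilDifferential (D : ι →₀ ℤ) : Submodule k (Module.Dual k 𝓥.adeles) :=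
  ((𝓥.adeleSpaceSupDiag D).submoduleOf 𝓥.adeles).dualAnnihilator

/-- The genus, computed over `k`: with `d` the degree over `k` of the field of constants, it is
`h¹(𝒪) - d + 1`. -/
noncomputable def genus : ℤ := sSup (Set.range 𝓥.defect) + 1

variable {𝓥}

theorem exists_mem_adeleSpace {α : ι → F} (hα : α ∈ 𝓥.adeles) (D₀ : ι →₀ ℤ) :
    ∃ D, D₀ ≤ D ∧ α ∈ 𝓥.adeleSpace D := by
  have hpole : (Function.support fun P => log (𝓥.v P (α P)) ⊔ 0).Finite := by
    refine hα.subset fun P hP hle => hP (sup_eq_right.2 ?_)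
    rcases eq_or_ne (𝓥.v P (α P)) 0 with h0 | h0
    · simp [h0]
    · exact (log_le_iff_le_exp h0).2 hle
  refine ⟨D₀ ⊔ Finsupp.ofSupportFinite _ hpole, le_sup_left, fun P => ?_⟩
  exact le_exp_log.trans (exp_le_exp.2 (le_sup_left.trans le_sup_right))

end Adeles

variable {𝓥 : PlaceFamily k F ι}

namespace IsComplete

variable (h : 𝓥.IsComplete)
include h

theorem diag_mem_adeles (f : F) : diag k F ι f ∈ 𝓥.adeles :=
  (h.finite_poles f).subset fun _ => lt_of_not_ge (α := ℤᵐ⁰)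

theorem adeleSpaceSupDiag_le_adeles (D : ι →₀ ℤ) : 𝓥.adeleSpaceSupDiag D ≤ 𝓥.adeles := by
  refine sup_le (𝓥.adeleSpace_le_adeles D) ?_
  rintro _ ⟨f, rfl⟩
  exact h.diag_mem_adeles f

theorem mem_weilDifferential {D : ι →₀ ℤ} {ω : Module.Dual k 𝓥.adeles} :
    ω ∈ 𝓥.weilDifferential D ↔
      (∀ α : 𝓥.adeles, α.1 ∈ 𝓥.adeleSpace D → ω α = 0) ∧
        ∀ f, ω ⟨diag k F ι f, h.diag_mem_adeles f⟩ = 0 := by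
  rw [weilDifferential, Submodule.mem_dualAnnihilator]
  refine ⟨fun hω => ⟨fun α hα => hω α (Submodule.mem_sup_left hα), fun f =>
    hω _ (Submodule.mem_sup_right (LinearMap.mem_range_self _ f))⟩, ?_⟩
  rintro ⟨hspace, hdiag⟩ α hα
  obtain ⟨β, hβ, _, ⟨f, rfl⟩, hsum⟩ := Submodule.mem_sup.1 hα
  have hα_eq : α = ⟨β, 𝓥.adeleSpace_le_adeles D hβ⟩ + ⟨diag k F ι f, h.diag_mem_adeles f⟩ :=
    Subtype.ext hsum.symm
  rw [hα_eq, map_add, hspace _ hβ, hdiag, add_zero]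

theorem mul_mem_adeles (f : F) {α : ι → F} (hα : α ∈ 𝓥.adeles) :
    (fun P => f * α P) ∈ 𝓥.adeles := by
  obtain ⟨E, -, hE⟩ := exists_mem_adeleSpace hα 0
  exact 𝓥.adeleSpace_le_adeles _ (mul_mem_adeleSpace (h.mem_riemannRochSpace_poleDivisor f) hE)

/-- The action of rational functions on adeles by multiplication. -/
noncomputable def mulAdele : F →ₐ[k] Module.End k 𝓥.adeles :=
  AlgHom.ofLinearMap
    (LinearMap.mk₂ k (fun f α => ⟨fun P => f * α.1 P, h.mul_mem_adeles f α.2⟩)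
      (fun f g α => by ext P; exact add_mul _ _ _)
      (fun c f α => by ext P; exact smul_mul_assoc _ _ _)
      (fun f α β => by ext P; exact mul_add _ _ _)
      (fun c f α => by ext P; exact mul_smul_comm _ _ _))
    (by ext α P; exact one_mul _)
    (fun f g => by ext α P; exact mul_assoc _ _ _)

/-- The functional `f ω`, for a rational function `f`. -/
noncomputable def twist (ω : Module.Dual k 𝓥.adeles) : F →ₗ[k] Module.Dual k 𝓥.adeles :=
  LinearMap.compRight k ω ∘ₗ h.mulAdele.toLinearMap

theorem twist_apply (ω : Module.Dual k 𝓥.adeles) (f : F) :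
    h.twist ω f = ω ∘ₗ h.mulAdele f := rfl

theorem twist_twist (ω : Module.Dual k 𝓥.adeles) (f g : F) :
    h.twist (h.twist ω f) g = h.twist ω (f * g) := by
  rw [twist_apply, twist_apply, twist_apply, map_mul]
  rfl

theorem twist_one (ω : Module.Dual k 𝓥.adeles) : h.twist ω 1 = ω := by
  rw [twist_apply, map_one]
  rfl

theorem twist_injective {ω : Module.Dual k 𝓥.adeles} (hω : ω ≠ 0) :
    Function.Injective (h.twist ω) := by
  refine (injective_iff_map_eq_zero _).2 fun f hf => ?_
  by_contra hf0
  apply hω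
  rw [← h.twist_one ω, ← mul_inv_cancel₀ hf0, ← twist_twist, hf]
  rfl

theorem twist_mem_weilDifferential {D E : ι →₀ ℤ} {ω : Module.Dual k 𝓥.adeles}
    (hω : ω ∈ 𝓥.weilDifferential D) {f : F} (hf : f ∈ 𝓥.riemannRochSpace (D - E)) :
    h.twist ω f ∈ 𝓥.weilDifferential E := by
  rw [h.mem_weilDifferential] at hω ⊢
  refine ⟨fun α hα => hω.1 _ ?_, fun g => hω.2 (f * g)⟩
  rw [← sub_add_cancel D E]
  exact mul_mem_adeleSpace hf hα

variable [Nonempty ι]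

theorem ell_eq_zero_of_degree_neg {D : ι →₀ ℤ} (hD : 𝓥.degree D < 0) : 𝓥.ell D = 0 := by
  by_contra hell
  obtain ⟨f, hf, hf0⟩ := h.exists_mem_riemannRochSpace_ne_zero (Nat.pos_of_ne_zero hell)
  have hdegree := 𝓥.degree_mono ((h.mem_riemannRochSpace_iff_neg_le hf0).1 hf)
  rw [map_neg, h.degree_principalDivisor, neg_zero] at hdegree
  exact hdegree.not_gt hD

theorem bddAbove_range_defect : BddAbove (Set.range 𝓥.defect) := by
  obtain ⟨c, hc⟩ := h.exists_forall_defect_le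
  exact ⟨c, Set.forall_mem_range.2 hc⟩

theorem defect_le (D : ι →₀ ℤ) : 𝓥.defect D ≤ 𝓥.genus - 1 := by
  rw [genus, add_sub_cancel_right]
  exact le_csSup h.bddAbove_range_defect (Set.mem_range_self D)

theorem exists_forall_defect_eq : ∃ D₀, ∀ D, D₀ ≤ D → 𝓥.defect D = 𝓥.genus - 1 := by
  obtain ⟨D₀, hD₀⟩ := Int.csSup_mem (Set.range_nonempty 𝓥.defect) h.bddAbove_range_defect
  refine ⟨D₀, fun D hD => (h.defect_le D).antisymm ?_⟩
  rw [genus, add_sub_cancel_right, ← hD₀]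
  exact h.defect_mono hD

theorem adeleSpaceSupDiag_eq_adeles {D : ι →₀ ℤ} (hD : 𝓥.defect D = 𝓥.genus - 1) :
    𝓥.adeleSpaceSupDiag D = 𝓥.adeles := by
  refine (h.adeleSpaceSupDiag_le_adeles D).antisymm fun α hα => ?_
  obtain ⟨D', hle, hα'⟩ := exists_mem_adeleSpace hα D
  have hdefect := h.defect_add_toNat_relLength hle
  have hdefect' := h.defect_le D'
  have hzero : relLength (𝓥.adeleSpaceSupDiag D) (𝓥.adeleSpaceSupDiag D') = 0 :=
    (ENat.toNat_eq_zero.1 (by omega)).resolve_right (h.relLength_adeleSpaceSupDiag_ne_top hle)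
  exact relLength_eq_zero.1 hzero (Submodule.mem_sup_left hα')

theorem toNat_relLength_adeles (D : ι →₀ ℤ) :
    ((relLength (𝓥.adeleSpaceSupDiag D) 𝓥.adeles).toNat : ℤ) = 𝓥.genus - 1 - 𝓥.defect D := by
  obtain ⟨D₀, hD₀⟩ := h.exists_forall_defect_eq
  have hmax := hD₀ (D ⊔ D₀) le_sup_right
  rw [← h.adeleSpaceSupDiag_eq_adeles hmax, ← hmax,
    ← h.defect_add_toNat_relLength (le_sup_left : D ≤ D ⊔ D₀)]
  ring

theorem relLength_adeles_ne_top (D : ι →₀ ℤ) :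
    relLength (𝓥.adeleSpaceSupDiag D) 𝓥.adeles ≠ ⊤ := by
  obtain ⟨D₀, hD₀⟩ := h.exists_forall_defect_eq
  rw [← h.adeleSpaceSupDiag_eq_adeles (hD₀ (D ⊔ D₀) le_sup_right)]
  exact h.relLength_adeleSpaceSupDiag_ne_top le_sup_left

theorem finite_weilDifferential (D : ι →₀ ℤ) : Module.Finite k (𝓥.weilDifferential D) :=
  have := finite_of_length_ne_top (h.relLength_adeles_ne_top D)
  .equiv (Submodule.dualQuotEquivDualAnnihilator _)

theorem finrank_weilDifferential (D : ι →₀ ℤ) :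
    (Module.finrank k (𝓥.weilDifferential D) : ℤ) = 𝓥.genus - 1 - 𝓥.defect D := by
  rw [← h.toNat_relLength_adeles, toNat_relLength, ← Subspace.dual_finrank_eq, weilDifferential,
    ← (Submodule.dualQuotEquivDualAnnihilator _).finrank_eq]

theorem exists_finrank_weilDifferential_lt (D D' : ι →₀ ℤ) :
    ∃ E, Module.finrank k (𝓥.weilDifferential E) < 𝓥.ell (D - E) + 𝓥.ell (D' - E) := by
  let P : ι := Classical.arbitrary ι
  let m : ℕ := (3 * 𝓥.genus - 𝓥.degree D - 𝓥.degree D').toNat + 1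
  let E : ι →₀ ℤ := -.single P (m : ℤ)
  have hm : 3 * 𝓥.genus - 𝓥.degree D - 𝓥.degree D' < m :=
    (Int.self_le_toNat _).trans_lt (Nat.cast_lt.2 (Nat.lt_succ_self _))
  have hE : (m : ℤ) ≤ -𝓥.degree E := by
    rw [map_neg, neg_neg, degree_single]
    exact le_mul_of_one_le_right (Nat.cast_nonneg m)
      (Nat.one_le_cast.2 (resDegree_pos h.finiteResidue P))
  have hell := h.ell_eq_zero_of_degree_neg (D := E) (by omega)
  have hdim := h.finrank_weilDifferential E
  have hD := h.defect_le (D - E)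
  have hD' := h.defect_le (D' - E)
  rw [defect, map_sub] at hD hD'
  rw [defect, hell] at hdim
  exact ⟨E, by omega⟩

/-- Weil differentials form a space of dimension one over the function field. -/
theorem exists_eq_twist {D D' : ι →₀ ℤ} {ω ω' : Module.Dual k 𝓥.adeles} (hω0 : ω ≠ 0)
    (hω : ω ∈ 𝓥.weilDifferential D) (hω' : ω' ∈ 𝓥.weilDifferential D') :
    ∃ g, ω' = h.twist ω g := by
  obtain ⟨E, hE⟩ := h.exists_finrank_weilDifferential_lt D D'
  have := h.finite_weilDifferential E
  have := h.finite_riemannRochSpace (D - E)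
  have := h.finite_riemannRochSpace (D' - E)
  -- `ω` and `ω'` are dependent since `L(D - E) ω` and `L(D' - E) ω'` are too large to be disjoint.
  let Φ : (𝓥.riemannRochSpace (D - E) × 𝓥.riemannRochSpace (D' - E)) →ₗ[k] 𝓥.weilDifferential E :=
    LinearMap.coprod
      ((h.twist ω).restrict fun _ hf => h.twist_mem_weilDifferential hω hf)
      ((h.twist ω').restrict fun _ hf => h.twist_mem_weilDifferential hω' hf)
  have hker_ne_bot : LinearMap.ker Φ ≠ ⊥ := by
    refine LinearMap.ker_ne_bot_of_finrank_lt (V₂ := 𝓥.weilDifferential E)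
      (V := 𝓥.riemannRochSpace (D - E) × 𝓥.riemannRochSpace (D' - E)) ?_
    rwa [Module.finrank_prod]
  obtain ⟨⟨f, g⟩, hker, hne⟩ := Submodule.exists_mem_ne_zero_of_ne_bot hker_ne_bot
  have hsum : h.twist ω f + h.twist ω' g = 0 := congrArg Subtype.val hker
  have hg0 : (g : F) ≠ 0 := fun hg0 => by
    rw [hg0, map_zero, add_zero] at hsum
    have hf0 : (f : F) = 0 := h.twist_injective hω0 (by rw [hsum, map_zero])
    exact hne (Prod.ext (Subtype.ext hf0) (Subtype.ext hg0))
  refine ⟨-f * (g : F)⁻¹, ?_⟩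
  rw [← twist_twist, map_neg, ← eq_neg_of_add_eq_zero_right hsum, twist_twist,
    mul_inv_cancel₀ hg0, twist_one]

end IsComplete

/-- `K` is the divisor of the Weil differential `ω`. -/
def IsDivisorOf (K : ι →₀ ℤ) (ω : Module.Dual k 𝓥.adeles) : Prop :=
  ∀ D, ω ∈ 𝓥.weilDifferential D ↔ D ≤ K

namespace IsDivisorOf

variable {K : ι →₀ ℤ} {ω : Module.Dual k 𝓥.adeles} (hK : IsDivisorOf K ω) (h : 𝓥.IsComplete)
include hK

theorem twist_mem_weilDifferential_iff {D : ι →₀ ℤ} {g : F} :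
    h.twist ω g ∈ 𝓥.weilDifferential D ↔ g ∈ 𝓥.riemannRochSpace (K - D) := by
  refine ⟨fun hmem => ?_, fun hg => h.twist_mem_weilDifferential ((hK K).2 le_rfl) hg⟩
  rcases eq_or_ne g 0 with rfl | hg0
  · exact zero_mem _
  have hinv : g⁻¹ ∈ 𝓥.riemannRochSpace (D - (D - h.principalDivisor g)) := by
    rw [h.mem_riemannRochSpace_iff_neg_le (inv_ne_zero hg0), h.principalDivisor_inv, neg_neg,
      sub_sub_cancel]
  have hω := h.twist_mem_weilDifferential hmem hinv
  rw [h.twist_twist, mul_inv_cancel₀ hg0, h.twist_one, hK, sub_le_iff_le_add] at hω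
  rwa [h.mem_riemannRochSpace_iff_neg_le hg0, neg_le_sub_iff_le_add]

variable [Nonempty ι]

theorem ne_zero : ω ≠ 0 := by
  classical
  rintro rfl
  have hle := (hK (K + .single (Classical.arbitrary ι) 1)).1 (zero_mem _) (Classical.arbitrary ι)
  simp at hle

include h

theorem finrank_weilDifferential (D : ι →₀ ℤ) :
    Module.finrank k (𝓥.weilDifferential D) = 𝓥.ell (K - D) := by
  have hmap : 𝓥.weilDifferential D = (𝓥.riemannRochSpace (K - D)).map (h.twist ω) := by
    ext ω'
    constructor
    · intro hω'
      obtain ⟨g, rfl⟩ := h.exists_eq_twist hK.ne_zero ((hK K).2 le_rfl) hω'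
      exact ⟨g, (hK.twist_mem_weilDifferential_iff h).1 hω', rfl⟩
    · rintro ⟨g, hg, rfl⟩
      exact (hK.twist_mem_weilDifferential_iff h).2 hg
  rw [hmap]
  exact (Submodule.equivMapOfInjective _ (h.twist_injective hK.ne_zero) _).finrank_eq.symm

theorem ell_sub_ell (D : ι →₀ ℤ) :
    (𝓥.ell D : ℤ) - 𝓥.ell (K - D) = 𝓥.degree D + 1 - 𝓥.genus := by
  rw [← hK.finrank_weilDifferential h, h.finrank_weilDifferential, defect]
  ring

theorem degree_eq : 𝓥.degree K = 2 * 𝓥.ell K - 2 * 𝓥.ell 0 := by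
  have hzero := hK.ell_sub_ell h 0
  have hcanonical := hK.ell_sub_ell h K
  rw [sub_zero, map_zero] at hzero
  rw [sub_self] at hcanonical
  omega

theorem degree_eq_of_neg (hneg : 𝓥.degree K < 0) : 𝓥.degree K = -2 * 𝓥.ell 0 := by
  rw [hK.degree_eq h, h.ell_eq_zero_of_degree_neg hneg]
  ring

end IsDivisorOf

/-- The same places, over a smaller field of constants. -/
def restrictScalars (k : Type*) {k' : Type*} [Field k] [Field k'] [Algebra k k'] [Algebra k F]
    [Algebra k' F] [IsScalarTower k k' F] (𝓥 : PlaceFamily k' F ι) : PlaceFamily k F ι where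
  v := 𝓥.v
  map_const_le_one P c := by
    rw [IsScalarTower.algebraMap_apply k k' F]
    exact 𝓥.map_const_le_one P _
  surjective := 𝓥.surjective

theorem resDegree_restrictScalars {k' : Type*} [Field k'] [Algebra k k'] [Algebra k' F]
    [IsScalarTower k k' F] (𝓥 : PlaceFamily k' F ι) (P : ι) :
    (𝓥.restrictScalars k).resDegree P = Module.finrank k k' * 𝓥.resDegree P :=
  toNat_relLength_restrictScalars (k := k) (𝓥.localIdeal P (-1)) (𝓥.localIdeal P 0)

/-- The same places, with the algebraic closure of `k` in `F` as field of constants. -/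
def extendConstants (𝓥 : PlaceFamily k F ι) : PlaceFamily (algebraicClosure k F) F ι where
  v := 𝓥.v
  map_const_le_one P c := map_le_one_of_isAlgebraic (mem_algebraicClosure_iff.1 c.2) P
  surjective := 𝓥.surjective

theorem IsComplete.ell_zero (h : 𝓥.IsComplete) :
    𝓥.ell 0 = Module.finrank k (algebraicClosure k F) := by
  have heq : 𝓥.riemannRochSpace 0 =
      Subalgebra.toSubmodule (algebraicClosure k F).toSubalgebra := by
    ext x
    exact h.mem_riemannRochSpace_zero_iff.trans mem_algebraicClosure_iff.symm
  rw [ell, heq]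
  rfl

theorem IsComplete.ell_zero_dvd_resDegree (h : 𝓥.IsComplete) (P : ι) :
    𝓥.ell 0 ∣ 𝓥.resDegree P :=
  ⟨_, h.ell_zero ▸ 𝓥.extendConstants.resDegree_restrictScalars P⟩

end PlaceFamily

/-! ### Commutative algebra -/

theorem exists_ringHom_comp_eq {A B K : Type*} [Ring A] [Ring B] [Ring K] {f : A →+* K}
    {g : B →+* K} (hg : Function.Injective g) (h : f.range ≤ g.range) :
    ∃ ψ : A →+* B, g.comp ψ = f := by
  let e : B ≃+* g.range := .ofBijective g.rangeRestrict
    ⟨fun a b hab => hg (congrArg Subtype.val hab), g.rangeRestrict_surjective⟩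
  refine ⟨e.symm.toRingHom.comp (f.codRestrict g.range fun a => h ⟨a, rfl⟩),
    RingHom.ext fun a => ?_⟩
  exact congrArg Subtype.val (e.apply_symm_apply ⟨f a, _⟩)

theorem exists_valuationSubring_notMem {k F : Type*} [Field k] [Field F] [Algebra k F] {x : F}
    (hx : Transcendental k x) :
    ∃ V : ValuationSubring F, (∀ c : k, algebraMap k F c ∈ V) ∧ x ∉ V := by
  have : IsIntegrallyClosedIn (integralClosure k F).toSubring F :=
    inferInstanceAs (IsIntegrallyClosedIn (integralClosure k F) F)
  obtain ⟨V, hV, hxV⟩ := Subring.exists_le_valuationSubring_of_isIntegrallyClosedIn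
    (R := (integralClosure k F).toSubring) (x := x) fun h => hx (IsIntegral.isAlgebraic h)
  exact ⟨V, fun c => hV (isIntegral_algebraMap (R := k)), hxV⟩

section AffineCurve

open Polynomial nonZeroDivisors

variable {k A : Type*} [Field k] [CommRing A] [Algebra k A] [Algebra.FiniteType k A]
  [Ring.KrullDimLE 1 A]

theorem finite_quotient_span_singleton {a : A} (ha : a ∈ A⁰) :
    Module.Finite k (A ⧸ Ideal.span {a}) := by
  have : IsNoetherianRing A := Algebra.FiniteType.isNoetherianRing k A
  have : IsArtinian A (A ⧸ Ideal.span {a}) :=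
    (isFiniteLength_iff_isNoetherian_isArtinian.1 (isFiniteLength_quotient_span_singleton A ha)).2
  have : IsArtinianRing (A ⧸ Ideal.span {a}) := isArtinian_of_tower A this
  exact Module.finite_of_isArtinianRing k (A ⧸ Ideal.span {a})

theorem exists_ne_zero_dvd_aeval (x : A) {a : A} (ha : a ∈ A⁰) :
    ∃ q : k[X], q ≠ 0 ∧ a ∣ aeval x q := by
  have := finite_quotient_span_singleton (k := k) ha
  obtain ⟨q, hq, hqx⟩ :=
    Algebra.IsIntegral.isIntegral (R := k) (Ideal.Quotient.mk (Ideal.span {a}) x)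
  refine ⟨q, hq.ne_zero, ?_⟩
  rw [← Ideal.mem_span_singleton, ← Ideal.Quotient.eq_zero_iff_mem, ← hqx]
  exact (aeval_algebraMap_apply (A ⧸ Ideal.span {a}) x q).symm

variable {F : Type*} [Field F] [Algebra A F] [IsFractionRing A F] [Algebra k F]
  [IsScalarTower k A F]

theorem adjoin_range_algebraMap_eq_top {x : A} (hx : Transcendental k (algebraMap A F x)) :
    Algebra.adjoin (IntermediateField.adjoin k {algebraMap A F x})
      (Set.range (algebraMap A F)) = ⊤ := by
  set y := algebraMap A F x with hy
  set E := IntermediateField.adjoin k {y}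
  set B := Algebra.adjoin E (Set.range (algebraMap A F))
  have hA (a : A) : algebraMap A F a ∈ B := Algebra.subset_adjoin ⟨a, rfl⟩
  have hinv (q : k[X]) : (aeval y q)⁻¹ ∈ B :=
    have hq : aeval y q ∈ E :=
      IntermediateField.algebra_adjoin_le_adjoin k {y} (aeval_mem_adjoin_singleton k y)
    B.algebraMap_mem ⟨_, E.inv_mem hq⟩
  rw [eq_top_iff]
  rintro z -
  obtain ⟨a, b, hb, rfl⟩ := IsFractionRing.div_surjective (A := A) z
  obtain ⟨q, hq, c, hc⟩ := exists_ne_zero_dvd_aeval (k := k) x hb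
  have hq0 : aeval y q ≠ 0 := fun h0 => hq (transcendental_iff.1 hx q h0)
  have hbc : aeval y q = algebraMap A F b * algebraMap A F c := by
    rw [← map_mul, ← hc, hy, aeval_algebraMap_apply]
  have : algebraMap A F a / algebraMap A F b =
      algebraMap A F a * (algebraMap A F c * (aeval y q)⁻¹) := by
    rw [hbc] at hq0 ⊢
    have := left_ne_zero_of_mul hq0
    have := right_ne_zero_of_mul hq0
    field_simp
  rw [this]
  exact B.mul_mem (hA a) (B.mul_mem (hA c) (hinv q))

theorem finiteDimensional_adjoin_of_transcendental {x : A}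
    (hx : Transcendental k (algebraMap A F x)) :
    FiniteDimensional (IntermediateField.adjoin k {algebraMap A F x}) F := by
  set E := IntermediateField.adjoin k {algebraMap A F x}
  obtain ⟨s, hs⟩ := (inferInstance : Algebra.FiniteType k A).out
  have hle : Set.range (algebraMap A F) ⊆ Algebra.adjoin E (algebraMap A F '' s) := by
    rw [← IsScalarTower.coe_toAlgHom' k A F, ← AlgHom.coe_range, ← Algebra.map_top, ← hs,
      AlgHom.map_adjoin]
    exact Algebra.adjoin_le (S := (Algebra.adjoin E _).restrictScalars k) Algebra.subset_adjoin
  have : Algebra.FiniteType E F := by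
    refine ⟨⟨(s.finite_toSet.image (algebraMap A F)).toFinset, ?_⟩⟩
    rw [Set.Finite.coe_toFinset, eq_top_iff, ← adjoin_range_algebraMap_eq_top hx]
    exact Algebra.adjoin_le hle
  exact finite_of_finite_type_of_isJacobsonRing E F

end AffineCurve

/-! ### The places of a proper regular curve -/

namespace ProperRegularCurve

section Points

variable {k : Type u} [Field k] (C : ProperRegularCurve k)

theorem krullDim_eq_one : Order.krullDim C.X = 1 := by
  rw [← C.dim_eq_one, topologicalKrullDim]
  exact (Order.krullDim_eq_of_orderIso (irreducibleSetEquivPoints (α := C.X))).symm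

theorem coheight_le_one (x : C.X) : Order.coheight x ≤ 1 := by
  have := Order.coheight_le_krullDim x
  rw [krullDim_eq_one] at this
  exact_mod_cast this

theorem lt_genericPoint {x : C.X} (hx : x ≠ genericPoint C.X) : x < genericPoint C.X :=
  have h : genericPoint C.X ⤳ x := (genericPoint_spec C.X).specializes trivial
  lt_of_le_not_ge h fun h' => hx (Specializes.antisymm h' h).eq

theorem coheight_eq_one {x : C.X} (hx : x ≠ genericPoint C.X) : Order.coheight x = 1 :=
  le_antisymm (C.coheight_le_one x)
    (le_trans (by simp) (Order.coheight_add_one_le (C.lt_genericPoint hx)))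

theorem isClosed_singleton_of_ne {x : C.X} (hx : x ≠ genericPoint C.X) :
    IsClosed ({x} : Set C.X) := by
  rw [← closure_subset_iff_isClosed]
  intro y hy
  have hxy : x ⤳ y := specializes_iff_mem_closure.2 hy
  by_contra hne
  have hlt : y < x := lt_of_le_not_ge hxy fun h => hne (Specializes.antisymm h hxy).eq
  have h := (Order.coheight_add_one_le hlt).trans (C.coheight_le_one y)
  rw [C.coheight_eq_one hx] at h
  exact absurd h (by decide)

theorem ne_genericPoint (P : C.ClosedPoint) : P.1 ≠ genericPoint C.X := by
  intro h
  have huniv : (Set.univ : Set C.X) = {P.1} := by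
    rw [← P.2.closure_eq, h]
    exact (genericPoint_spec C.X).def.symm
  have : Subsingleton C.X :=
    Set.subsingleton_univ_iff.1 (huniv ▸ Set.subsingleton_singleton)
  have hdim : Order.krullDim C.X ≤ 0 := Order.krullDim_nonpos_of_subsingleton
  rw [krullDim_eq_one] at hdim
  exact absurd hdim (by decide)

theorem coheight_closedPoint (P : C.ClosedPoint) : Order.coheight P.1 = 1 :=
  C.coheight_eq_one (C.ne_genericPoint P)

instance (P : C.ClosedPoint) : IsDiscreteValuationRing (C.X.presheaf.stalk P.1) := by
  have := C.regular P.1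
  rw [← IsLocalRing.finrank_CotangentSpace_eq_one_iff]
  have h := (IsRegularLocalRing.iff_finrank_cotangentSpace (R := C.X.presheaf.stalk P.1)).1 this
  rw [ringKrullDim_stalk_eq_coheight, coheight_closedPoint] at h
  exact_mod_cast h

/-- The normalized valuation of the function field at a closed point, written multiplicatively:
an element of order `n` has valuation `exp (-n)`. -/
noncomputable def val (P : C.ClosedPoint) : Valuation C.X.functionField ℤᵐ⁰ :=
  (IsDiscreteValuationRing.maximalIdeal (C.X.presheaf.stalk P.1)).valuation C.X.functionField

theorem val_le_one_iff (P : C.ClosedPoint) (f : C.X.functionField) :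
    C.val P f ≤ 1 ↔ f ∈ (algebraMap (C.X.presheaf.stalk P.1) C.X.functionField).range := by
  constructor
  · exact fun h => (IsDiscreteValuationRing.exists_lift_of_le_one h)
  · rintro ⟨a, rfl⟩
    exact IsDedekindDomain.HeightOneSpectrum.valuation_le_one _ _

theorem val_algebraMap_lt_one_iff (P : C.ClosedPoint) (a : C.X.presheaf.stalk P.1) :
    C.val P (algebraMap _ C.X.functionField a) < 1 ↔ C.X.residue P.1 a = 0 := by
  rw [val, IsDedekindDomain.HeightOneSpectrum.valuation_lt_one_iff_mem]
  exact (IsLocalRing.residue_eq_zero_iff a).symm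

theorem log_val (P : C.ClosedPoint) {f : C.X.functionField} (hf : f ≠ 0) :
    log (C.val P f) = -Scheme.ord f P.1 := by
  rw [← neg_eq_iff_eq_neg, ← log_inv, eq_comm, Scheme.ord_eq_iff (C.coheight_closedPoint P) hf]
  refine (Ring.ordFrac_eq_valuation_inv f).trans ?_
  exact (exp_log (by simpa using hf)).symm

theorem memAdele_iff (D : C.WeilDivisor ℤ) (α : C.ClosedPoint → C.X.functionField) :
    MemAdele D α ↔ ∀ P, C.val P (α P) ≤ exp (D P) := by
  refine forall_congr' fun P => ?_
  rcases eq_or_ne (α P) 0 with h0 | h0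
  · simp [h0]
  · rw [← log_le_iff_le_exp (by simpa using h0), log_val C P h0, neg_le_iff_add_nonneg]
    simp only [h0, false_or, add_comm]

/-- The family of places of the function field given by the closed points. -/
noncomputable def places : PlaceFamily k C.X.functionField C.ClosedPoint where
  v := C.val
  map_const_le_one P _ := (C.val_le_one_iff P _).2 ⟨_, C.algebraMap_toStalk P.1 _⟩
  surjective _ := IsDedekindDomain.HeightOneSpectrum.valuation_surjective _ _

theorem adele_eq : C.adele = C.places.adeles := by
  ext α
  change (∀ᶠ P in Filter.cofinite, _) ↔ _
  exact Filter.eventually_congr (.of_forall fun P => (C.val_le_one_iff P (α P)).symm)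

end Points

section LocalRings

variable {k : Type u} [Field k] (C : ProperRegularCurve k)

theorem fromSpecStalk_toBase (x : C.X) :
    C.X.fromSpecStalk x ≫ C.toBase = Spec.map (CommRingCat.ofHom (C.toStalk x)) := by
  apply ext_of_isAffine
  rw [Scheme.Hom.comp_appTop, Scheme.fromSpecStalk_appTop,
    ← cancel_epi (Scheme.ΓSpecIso (CommRingCat.of k)).inv, ← Scheme.ΓSpecIso_inv_naturality]
  simp [toStalk]

theorem SpecMap_algebraMap_fromSpecStalk (x : C.X) :
    Spec.map (CommRingCat.ofHom (algebraMap (C.X.presheaf.stalk x) C.X.functionField)) ≫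
      C.X.fromSpecStalk x = C.X.fromSpecStalk (genericPoint C.X) :=
  Scheme.SpecMap_stalkSpecializes_fromSpecStalk ((genericPoint_spec C.X).specializes trivial)

theorem isDominant_SpecMap_algebraMap (x : C.X) : IsDominant
    (Spec.map (CommRingCat.ofHom (algebraMap (C.X.presheaf.stalk x) C.X.functionField))) := by
  refine ⟨(PrimeSpectrum.denseRange_comap_iff_ker_le_nilRadical _).2 ?_⟩
  exact ((RingHom.injective_iff_ker_eq_bot _).1
    (IsFractionRing.injective _ C.X.functionField)).trans_le bot_le

theorem SpecMap_fromSpecStalk_of_comp_eq {x y : C.X}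
    {ψ : C.X.presheaf.stalk x →+* C.X.presheaf.stalk y}
    (hψ : (algebraMap (C.X.presheaf.stalk y) C.X.functionField).comp ψ =
      algebraMap (C.X.presheaf.stalk x) C.X.functionField) :
    Spec.map (CommRingCat.ofHom ψ) ≫ C.X.fromSpecStalk x = C.X.fromSpecStalk y := by
  have hinj := IsFractionRing.injective (C.X.presheaf.stalk y) C.X.functionField
  have hψk : ψ.comp (C.toStalk x) = C.toStalk y := by
    ext c
    apply hinj
    rw [← RingHom.comp_apply, ← RingHom.comp_assoc, hψ, RingHom.comp_apply, algebraMap_toStalk,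
      algebraMap_toStalk]
  -- Both morphisms to the separated scheme `C` agree on the dense generic point.
  have := C.isDominant_SpecMap_algebraMap y
  refine ext_of_isDominant_of_isSeparated C.toBase ?_
    (Spec.map (CommRingCat.ofHom (algebraMap (C.X.presheaf.stalk y) C.X.functionField))) ?_
  · rw [Category.assoc, fromSpecStalk_toBase, fromSpecStalk_toBase, ← Spec.map_comp,
      ← CommRingCat.ofHom_comp, hψk]
  · rw [← Category.assoc, ← Spec.map_comp, ← CommRingCat.ofHom_comp, hψ,
      SpecMap_algebraMap_fromSpecStalk, SpecMap_algebraMap_fromSpecStalk]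

theorem specializes_of_range_algebraMap_le {x y : C.X}
    (h : (algebraMap (C.X.presheaf.stalk x) C.X.functionField).range ≤
      (algebraMap (C.X.presheaf.stalk y) C.X.functionField).range) : y ⤳ x := by
  obtain ⟨ψ, hψ⟩ := exists_ringHom_comp_eq
    (IsFractionRing.injective (C.X.presheaf.stalk y) C.X.functionField) h
  have hy : y ∈ Set.range (C.X.fromSpecStalk x) := by
    rw [← Scheme.fromSpecStalk_closedPoint (X := C.X) (x := y),
      ← C.SpecMap_fromSpecStalk_of_comp_eq hψ]
    exact ⟨_, (Scheme.Hom.comp_apply _ _ _).symm⟩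
  rwa [Scheme.range_fromSpecStalk] at hy

theorem places_independent : C.places.Independent := by
  intro P Q hPQ
  by_contra! hle
  have hQP : Q.1 ⤳ P.1 := C.specializes_of_range_algebraMap_le fun f hf =>
    (C.val_le_one_iff Q f).1 (hle f ((C.val_le_one_iff P f).2 hf))
  have hP : P.1 ∈ closure ({Q.1} : Set C.X) := specializes_iff_mem_closure.1 hQP
  rw [Q.2.closure_eq] at hP
  exact hPQ (Subtype.ext hP)

end LocalRings

section Completeness

variable {k : Type u} [Field k] (C : ProperRegularCurve k)

theorem range_algebraMap_stalk_eq_top {p : C.X} (hp : p = genericPoint C.X) :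
    (algebraMap (C.X.presheaf.stalk p) C.X.functionField).range = ⊤ := by
  subst hp
  refine RingHom.range_eq_top.2 fun x => ⟨x, ?_⟩
  change (C.X.presheaf.stalkSpecializes _).hom x = x
  rw [TopCat.Presheaf.stalkSpecializes_refl]
  rfl

theorem exists_range_algebraMap_stalk_le (V : ValuationSubring C.X.functionField)
    (hV : ∀ c : k, algebraMap k C.X.functionField c ∈ V) :
    ∃ p : C.X, (algebraMap (C.X.presheaf.stalk p) C.X.functionField).range ≤ V.toSubring := by
  let φ : k →+* V := (algebraMap k C.X.functionField).codRestrict V hV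
  have hφ : (algebraMap V C.X.functionField).comp φ = C.toStalk (genericPoint C.X) := rfl
  let S : ValuativeCommSq C.toBase :=
    { R := V
      K := C.X.functionField
      i₁ := C.X.fromSpecStalk (genericPoint C.X)
      i₂ := Spec.map (CommRingCat.ofHom φ)
      commSq := ⟨by
        rw [C.fromSpecStalk_toBase, ← Spec.map_comp, ← CommRingCat.ofHom_comp, hφ]⟩ }
  have hE : ValuativeCriterion.Existence C.toBase :=
    (UniversallyClosed.eq_valuativeCriterion.le _ _ _
      (inferInstance : UniversallyClosed C.toBase)).1
  obtain ⟨⟨l, hl, -⟩⟩ := (hE S).exists_lift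
  replace hl : Spec.map (CommRingCat.ofHom (algebraMap V C.X.functionField)) ≫ l =
    C.X.fromSpecStalk (genericPoint C.X) := hl
  let p := l (IsLocalRing.closedPoint V)
  have hp : CommRingCat.ofHom (algebraMap (C.X.presheaf.stalk p) C.X.functionField) =
      Scheme.stalkClosedPointTo l ≫ CommRingCat.ofHom (algebraMap V C.X.functionField) := by
    apply Spec.map_injective
    rw [← cancel_mono (C.X.fromSpecStalk p), SpecMap_algebraMap_fromSpecStalk, Spec.map_comp,
      Category.assoc, Scheme.Spec_stalkClosedPointTo_fromSpecStalk, hl]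
  refine ⟨p, ?_⟩
  rintro _ ⟨a, rfl⟩
  rw [show algebraMap (C.X.presheaf.stalk p) C.X.functionField a =
    algebraMap V C.X.functionField ((Scheme.stalkClosedPointTo l).hom a) from
      DFunLike.congr_fun (congrArg CommRingCat.Hom.hom hp) a]
  exact ((Scheme.stalkClosedPointTo l).hom a).2

theorem exists_pole {x : C.X.functionField} (hx : Transcendental k x) :
    ∃ P, 1 < C.places.v P x := by
  obtain ⟨V, hkV, hxV⟩ := exists_valuationSubring_notMem hx
  obtain ⟨p, hp⟩ := C.exists_range_algebraMap_stalk_le V hkV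
  have hpx : x ∉ (algebraMap (C.X.presheaf.stalk p) C.X.functionField).range :=
    fun h => hxV (hp h)
  have hne : p ≠ genericPoint C.X := fun h => by
    simp [C.range_algebraMap_stalk_eq_top h] at hpx
  let P : C.ClosedPoint := ⟨p, C.isClosed_singleton_of_ne hne⟩
  exact ⟨P, not_le.1 fun h => hpx ((C.val_le_one_iff P x).1 h)⟩

theorem finite_residueField (P : C.ClosedPoint) : Module.Finite k (C.X.residueField P.1) := by
  have hSpec : C.X.fromSpecResidueField P.1 ≫ C.toBase =
      Spec.map (CommRingCat.ofHom (algebraMap k (C.X.residueField P.1))) := by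
    rw [show CommRingCat.ofHom (algebraMap k (C.X.residueField P.1)) =
        CommRingCat.ofHom (C.toStalk P.1) ≫ C.X.residue P.1 from rfl,
      Spec.map_comp, ← fromSpecStalk_toBase, Scheme.fromSpecResidueField, Category.assoc]
  have hfin : IsFinite (C.X.fromSpecResidueField P.1 ≫ C.toBase) := by
    have := isClosed_singleton_iff_isClosedImmersion.1 P.2
    rw [isFinite_iff_locallyOfFiniteType_of_jacobsonSpace]
    infer_instance
  rw [hSpec, IsFinite.SpecMap_iff] at hfin
  exact RingHom.finite_algebraMap.1 hfin

noncomputable instance (x : C.X) : Algebra k (C.X.presheaf.stalk x) := (C.toStalk x).toAlgebra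

instance (x : C.X) : IsScalarTower k (C.X.presheaf.stalk x) C.X.functionField :=
  .of_algebraMap_eq fun c => (C.algebraMap_toStalk x c).symm

/-- Reduction modulo the maximal ideal of the local ring at `x`. -/
noncomputable def residueLinearMap (x : C.X) :
    C.X.presheaf.stalk x →ₗ[k] C.X.residueField x where
  toFun := C.X.residue x
  map_add' := map_add _
  map_smul' c a := by
    rw [Algebra.smul_def, map_mul, RingHom.id_apply, Algebra.smul_def]
    rfl

theorem range_linearMap_stalk (P : C.ClosedPoint) :
    LinearMap.range (IsScalarTower.toAlgHom k (C.X.presheaf.stalk P.1)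
      C.X.functionField).toLinearMap = C.places.localIdeal P 0 := by
  ext x
  exact (C.val_le_one_iff P x).symm

theorem map_ker_residueLinearMap (P : C.ClosedPoint) :
    (LinearMap.ker (C.residueLinearMap P.1)).map (IsScalarTower.toAlgHom k
      (C.X.presheaf.stalk P.1) C.X.functionField).toLinearMap = C.places.localIdeal P (-1) := by
  ext x
  constructor
  · rintro ⟨a, ha, rfl⟩
    exact C.places.mem_localIdeal_neg_one.2 ((C.val_algebraMap_lt_one_iff P a).2 ha)
  · intro hx
    have hlt : C.val P x < 1 := C.places.mem_localIdeal_neg_one.1 hx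
    obtain ⟨a, rfl⟩ := (C.val_le_one_iff P x).1 hlt.le
    exact ⟨a, (C.val_algebraMap_lt_one_iff P a).1 hlt, rfl⟩

theorem relLength_localIdeal_eq_finrank (P : C.ClosedPoint) :
    relLength (C.places.localIdeal P (-1)) (C.places.localIdeal P 0) =
      Module.finrank k (C.X.residueField P.1) := by
  have := C.finite_residueField P
  rw [← map_ker_residueLinearMap, ← range_linearMap_stalk, LinearMap.range_eq_map,
    relLength_map (IsFractionRing.injective (C.X.presheaf.stalk P.1) C.X.functionField),
    relLength_ker_top (C.X.residue_surjective P.1), Module.length_eq_finrank]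

theorem places_finiteResidue : C.places.FiniteResidue := fun P => by
  rw [relLength_localIdeal_eq_finrank]
  exact ENat.natCast_ne_top _

theorem resDegree_eq_finrank (P : C.ClosedPoint) :
    C.places.resDegree P = Module.finrank k (C.X.residueField P.1) := by
  rw [PlaceFamily.resDegree, relLength_localIdeal_eq_finrank, ENat.toNat_natCast]

theorem finite_adjoin {x : C.X.functionField} (hx : Transcendental k x) :
    FiniteDimensional (IntermediateField.adjoin k {x}) C.X.functionField := by
  obtain ⟨U, hU, f, hne, rfl, -⟩ := exists_isUnit_germ_eq C.X x
    (fun h => hx (h ▸ isAlgebraic_zero))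
  have hU : IsAffineOpen U := hU
  have := functionField_isFractionRing_of_isAffineOpen C.X U hU
  let φ : k →+* Γ(C.X, U) :=
    ((Scheme.ΓSpecIso (CommRingCat.of k)).inv ≫ C.toBase.appLE ⊤ U (by simp)).hom
  let : Algebra k Γ(C.X, U) := φ.toAlgebra
  have : IsScalarTower k Γ(C.X, U) C.X.functionField := by
    refine IsScalarTower.of_algebraMap_eq' ?_
    have hgU : genericPoint C.X ∈ U :=
      ((genericPoint_spec C.X).mem_open_set_iff U.isOpen).2 (by simpa using hne)
    have hgerm := C.X.presheaf.germ_res (homOfLE le_top : U ⟶ ⊤) (genericPoint C.X) hgU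
    exact congrArg (fun g => ((Scheme.ΓSpecIso (CommRingCat.of k)).inv ≫
      C.toBase.appTop ≫ g).hom) hgerm.symm
  have : Algebra.FiniteType k Γ(C.X, U) := by
    have h := LocallyOfFiniteType.finiteType_appLE C.toBase (isAffineOpen_top _) hU (by simp)
    exact RingHom.finiteType_algebraMap.1 (h.comp (RingHom.FiniteType.of_surjective _
      (ConcreteCategory.bijective_of_isIso (Scheme.ΓSpecIso (CommRingCat.of k)).inv).2))
  have : Ring.KrullDimLE 1 Γ(C.X, U) := by
    rw [Ring.krullDimLE_iff, ← PrimeSpectrum.topologicalKrullDim_eq_ringKrullDim]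
    exact (hU.fromSpec.isOpenEmbedding.isInducing.topologicalKrullDim_le).trans C.dim_eq_one.le
  exact finiteDimensional_adjoin_of_transcendental hx

theorem places_isComplete : C.places.IsComplete where
  finiteResidue := C.places_finiteResidue
  independent := C.places_independent
  finite_adjoin _ := C.finite_adjoin
  exists_pole _ := C.exists_pole

end Completeness

section CanonicalDegree

variable {k : Type u} [Field k] {C : ProperRegularCurve k}

theorem WeilDivisor.degree_add (D D' : C.WeilDivisor ℝ) :
    (D + D').degree = D.degree + D'.degree :=
  Finsupp.sum_add_index' (by simp) (by intros; ring)

theorem WeilDivisor.degree_eq_sum (D : C.WeilDivisor ℝ) :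
    D.degree = ∑ P ∈ D.support, (C.places.resDegree P : ℝ) * D P := by
  simp only [WeilDivisor.degree, Finsupp.sum, resDegree_eq_finrank]

theorem WeilDivisor.degree_toReal (K : C.WeilDivisor ℤ) :
    K.toReal.degree = (C.places.degree K : ℝ) := by
  rw [WeilDivisor.degree, WeilDivisor.toReal, Finsupp.sum_mapRange_index (by simp),
    PlaceFamily.degree_eq_sum, Finsupp.sum, Finsupp.sum]
  push_cast
  exact Finset.sum_congr rfl fun P _ => by rw [resDegree_eq_finrank, mul_comm]

theorem IsCanonical.exists_isDivisorOf {K : C.WeilDivisor ℤ} (hK : IsCanonical K) :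
    ∃ ω, C.places.IsDivisorOf K ω := by
  obtain ⟨ω, -, hdiag, hdiv⟩ := hK
  simp only [memAdele_iff] at hdiv
  revert ω
  rw [C.adele_eq]
  intro ω hdiag hdiv
  refine ⟨ω, fun D => ?_⟩
  rw [C.places_isComplete.mem_weilDifferential, ← hdiv]
  exact and_iff_left fun f => hdiag _ ⟨f, fun P => rfl⟩

theorem IsCanonical.exists_degree_eq_neg_two_mul [Nonempty C.ClosedPoint] {K : C.WeilDivisor ℤ}
    (hK : IsCanonical K) (hneg : C.places.degree K < 0) :
    ∃ d : ℕ, C.places.degree K = -2 * d ∧ ∀ P, d ∣ C.places.resDegree P := by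
  obtain ⟨ω, hω⟩ := hK.exists_isDivisorOf
  exact ⟨C.places.ell 0, hω.degree_eq_of_neg C.places_isComplete hneg,
    C.places_isComplete.ell_zero_dvd_resDegree⟩

theorem WeilDivisor.degree_pos {D : C.WeilDivisor ℝ} (hD : 0 < D) : 0 < D.degree := by
  rw [degree_eq_sum]
  refine Finset.sum_pos (fun P hP => mul_pos ?_ ?_) (Finsupp.support_nonempty_iff.2 hD.ne')
  · exact_mod_cast PlaceFamily.resDegree_pos C.places_finiteResidue P
  · exact (hD.le P).lt_of_ne' (Finsupp.mem_support_iff.1 hP)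

theorem IsCanonical.exists_multiplicities {K : C.WeilDivisor ℤ} {Δ : C.WeilDivisor ℝ}
    (hK : IsCanonical K) (hΔ : 0 < Δ) (hnum : (K.toReal + Δ).IsNumTrivial) :
    ∃ m : C.ClosedPoint → ℕ, (∀ P, 0 < m P) ∧ Δ.sum (fun P a => m P * a) = 2 := by
  obtain ⟨P₀, -⟩ := Finsupp.support_nonempty_iff.2 hΔ.ne'
  have : Nonempty C.ClosedPoint := ⟨P₀⟩
  rw [WeilDivisor.IsNumTrivial, WeilDivisor.degree_add, WeilDivisor.degree_toReal] at hnum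
  have hneg : C.places.degree K < 0 := by
    have := WeilDivisor.degree_pos hΔ
    exact_mod_cast (by linarith : (C.places.degree K : ℝ) < 0)
  obtain ⟨d, hd, hdvd⟩ := hK.exists_degree_eq_neg_two_mul hneg
  choose m hm using hdvd
  have hd0 : (d : ℝ) ≠ 0 := Nat.cast_ne_zero.2 (by rintro rfl; simp [hd] at hneg)
  have hdegree : Δ.degree = d * Δ.sum fun P a => m P * a := by
    simp only [WeilDivisor.degree_eq_sum, hm, Finsupp.sum, Finset.mul_sum, Nat.cast_mul, mul_assoc]
  refine ⟨m, fun P => ?_, mul_left_cancel₀ hd0 ?_⟩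
  · have hpos := PlaceFamily.resDegree_pos C.places_finiteResidue P
    rw [hm P] at hpos
    exact Nat.pos_of_mul_pos_left hpos
  · rw [← hdegree]
    rw [hd] at hnum
    push_cast at hnum
    linarith

end CanonicalDegree

end ProperRegularCurve

/-! ### The descending chain condition -/

namespace IsDCC

variable {I : Set ℝ}

theorem isPWO (h : IsDCC I) : I.IsPWO := by
  rw [Set.isPWO_iff_isWF, Set.isWF_iff_no_descending_seq]
  rintro a ha haI
  obtain ⟨N, hN⟩ := h a haI ha.antitone
  exact (ha N.lt_succ_self).ne' (hN N le_rfl)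

theorem finite_setOf_sum_eq {ι : Type*} [Fintype ι] (h : IsDCC I) (c : ℝ) :
    {x : ι → ℝ | (∀ i, x i ∈ I) ∧ ∑ i, x i = c}.Finite := by
  have hpwo : {x : ι → ℝ | (∀ i, x i ∈ I) ∧ ∑ i, x i = c}.IsPWO :=
    (Set.IsPWO.pi fun _ => h.isPWO).mono fun x hx i _ => hx.1 i
  -- Tuples with a fixed sum form an antichain for the componentwise order.
  refine IsAntichain.finite_of_partiallyWellOrderedOn (r := (· ≤ ·)) ?_ hpwo
  rintro x ⟨-, hx⟩ y ⟨-, hy⟩ hxy hle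
  refine hxy (funext fun i => ?_)
  exact (Finset.sum_eq_sum_iff_of_le fun i _ => hle i).1 (hx.trans hy.symm) i (Finset.mem_univ i)

theorem exists_pos_forall_le (h : IsDCC I) : ∃ ε > 0, ∀ a ∈ I, 0 < a → ε ≤ a := by
  have hwf : (I ∩ Set.Ioi 0).IsWF := h.isPWO.isWF.mono Set.inter_subset_left
  by_cases hne : (I ∩ Set.Ioi 0).Nonempty
  · exact ⟨hwf.min hne, (hwf.min_mem hne).2, fun a ha h0 => hwf.min_le hne ⟨ha, h0⟩⟩
  · exact ⟨1, one_pos, fun a ha h0 => absurd ⟨a, ha, h0⟩ hne⟩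

theorem finite_setOf_mem_multiset_sum_eq (h : IsDCC I) (c : ℝ) :
    {a | ∃ s : Multiset ℝ, a ∈ s ∧ (∀ b ∈ s, b ∈ I ∧ 0 < b) ∧ s.sum = c}.Finite := by
  obtain ⟨ε, hε, hle⟩ := h.exists_pos_forall_le
  have hfin : (⋃ n ∈ Set.Iic ⌊c / ε⌋₊,
      ⋃ x ∈ {x : Fin n → ℝ | (∀ i, x i ∈ I) ∧ ∑ i, x i = c}, Set.range x).Finite :=
    (Set.finite_Iic _).biUnion fun n _ =>
      (h.finite_setOf_sum_eq c).biUnion fun x _ => Set.finite_range x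
  refine hfin.subset ?_
  rintro a ⟨⟨l⟩, ha, hl, hsum⟩
  have hlength : l.length ≤ ⌊c / ε⌋₊ := by
    refine Nat.le_floor ((le_div_iff₀ hε).2 ?_)
    rw [← hsum, ← nsmul_eq_mul]
    exact Multiset.card_nsmul_le_sum fun b hb => hle b (hl b hb).1 (hl b hb).2
  simp only [Set.mem_iUnion]
  refine ⟨l.length, hlength, l.get, ⟨fun i => (hl _ (l.get_mem i)).1, ?_⟩, List.mem_iff_get.1 ha⟩
  rw [← List.sum_ofFn, List.ofFn_get]
  exact hsum

end IsDCC

theorem mainTheorem7_general (I : Set ℝ) (hI : I ⊆ Set.Ici 0) (hdcc : IsDCC I) :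
    ∃ I₀ : Set ℝ, I₀ ⊆ I ∧ I₀.Finite ∧
      ∀ (k : Type u) [Field k] (C : ProperRegularCurve k)
        (K : C.WeilDivisor ℤ) (Δ : C.WeilDivisor ℝ),
        ProperRegularCurve.IsCanonical K →
        Δ.coeffs ⊆ I →
        (K.toReal + Δ).IsNumTrivial →
        Δ.coeffs ⊆ I₀ := by
  refine ⟨{a | ∃ s : Multiset ℝ, a ∈ s ∧ (∀ b ∈ s, b ∈ I ∧ 0 < b) ∧ s.sum = 2},
    fun a ⟨_, ha, hs, _⟩ => (hs a ha).1, hdcc.finite_setOf_mem_multiset_sum_eq 2, ?_⟩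
  rintro k _ C K Δ hK hcoeffs hnum _ ⟨P, hP, rfl⟩
  have hmem : ∀ Q ∈ Δ.support, Δ Q ∈ I := fun Q hQ => hcoeffs ⟨Q, hQ, rfl⟩
  have hpos : ∀ Q ∈ Δ.support, 0 < Δ Q := fun Q hQ =>
    (hI (hmem Q hQ)).lt_of_ne' (Finsupp.mem_support_iff.1 hQ)
  have hΔ : 0 < Δ := by
    refine lt_of_le_of_ne (fun Q => ?_) (Finsupp.support_nonempty_iff.1 ⟨P, hP⟩).symm
    by_cases hQ : Q ∈ Δ.support
    · exact (hpos Q hQ).le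
    · exact (Finsupp.notMem_support_iff.1 hQ).ge
  obtain ⟨m, hm, hsum⟩ := hK.exists_multiplicities hΔ hnum
  refine ⟨∑ Q ∈ Δ.support, Multiset.replicate (m Q) (Δ Q), ?_, fun b hb => ?_, ?_⟩
  · exact Multiset.mem_sum.2 ⟨P, hP, Multiset.mem_replicate.2 ⟨(hm P).ne', rfl⟩⟩
  · obtain ⟨Q, hQ, hb⟩ := Multiset.mem_sum.1 hb
    rw [Multiset.eq_of_mem_replicate hb]
    exact ⟨hmem Q hQ, hpos Q hQ⟩
  · rw [← hsum, ← Multiset.coe_sumAddMonoidHom, map_sum]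
    simp [Finsupp.sum]

theorem mainTheorem7 (I : Set ℝ) (hI : I ⊆ Set.Icc 0 1) (hdcc : IsDCC I) :
    ∃ I₀ : Set ℝ, I₀ ⊆ I ∧ I₀.Finite ∧
      ∀ (k : Type u) [Field k] (C : ProperRegularCurve k)
        (K : C.WeilDivisor ℤ) (Δ : C.WeilDivisor ℝ),
        ProperRegularCurve.IsCanonical K →
        Δ.coeffs ⊆ I →
        (K.toReal + Δ).IsNumTrivial →
        Δ.coeffs ⊆ I₀ :=
  mainTheorem7_general I (hI.trans Set.Icc_subset_Ici_self) hdcc
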